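/- Let $N\ge 3$ and let $V\in L^\infty(\mathbb R^N)$ be a real $\mathbb Z^N$-periodic function with $\operatorname{ess\,inf}_{\mathbb R^N}V>0$. For $0<s<1$ let $$H^s(\mathbb R^N)=\Big\{u\in L^2(\mathbb R^N;\mathbb R)\;:\;\int_{\mathbb R^N\times\mathbb R^N}\frac{|u(x)-u(y)|^2}{|x-y|^{N+2s}}\,dx\,dy<\infty\Big\},$$ with the norm $$\|u\|_s^2=\|(-\Delta)^{s/2}u\|_{L^2(\mathbb R^N)}^2+\int_{\mathbb R^N}V u^2\,dx,\qquad \|(-\Delta)^{s/2}u\|_{L^2(\mathbb R^N)}^2=\frac{C(N,s)}2\int_{\mathbb R^N\times\mathbb R^N}\frac{|u(x)-u(y)|^2}{|x-y|^{N+2s}}\,dx\,dy,$$ where $\frac1{C(N,s)}=\int_{\mathbb R^N}\frac{1-\cos\zeta_1}{|\zeta|^{N+2s}}\,d\zeta$. Let $(s_n)_n\subset(1/2,1)$ be a sequence with $s_n\to1$, and let $v_n\in H^{s_n}(\mathbb R^N)$ satisfy $\sup_n\|v_n\|_{s_n}<\infty$. Then there are a function $v\in H^1(\mathbb R^N)$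 and a subsequence $(v_{n_k})_k$ such that $v_{n_k}\to v$ in $L^q_{\mathrm{loc}}(\mathbb R^N)$ for every $q\in[2,\tfrac{2N}{N-1})$ and $v_{n_k}\to v$ almost everywhere in $\mathbb R^N$. -/

import Mathlib

open MeasureTheory Filter Topology
open scoped ENNReal ContDiff

noncomputable section

namespace FracSobolev

/-- The squared Gagliardo seminorm
`∫∫_{ℝᴺ × ℝᴺ} |u(x) - u(y)|² / |x - y|^(N + 2s) dx dy`, with values in `[0, ∞]`. -/
def gagliardoSq {N : ℕ} (s : ℝ) (u : EuclideanSpace ℝ (Fin N) → ℝ) : ℝ≥0∞ :=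
  ∫⁻ p : EuclideanSpace ℝ (Fin N) × EuclideanSpace ℝ (Fin N),
    ENNReal.ofReal (|u p.1 - u p.2| ^ 2 / ‖p.1 - p.2‖ ^ ((N : ℝ) + 2 * s))

/-- `u` belongs to the fractional Sobolev space `Hˢ(ℝᴺ)`, `0 < s < 1`. -/
def MemHs {N : ℕ} (s : ℝ) (u : EuclideanSpace ℝ (Fin N) → ℝ) : Prop :=
  MemLp u 2 volume ∧ gagliardoSq s u < ⊤

/-- The normalizing constant `C(N, s)` of the fractional Laplacian,
`1 / C(N, s) = ∫_{ℝᴺ} (1 - cos ζ₁) / |ζ|^(N + 2s) dζ`. -/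
def fracConst (N : ℕ) [NeZero N] (s : ℝ) : ℝ :=
  (∫ ζ : EuclideanSpace ℝ (Fin N), (1 - Real.cos (ζ 0)) / ‖ζ‖ ^ ((N : ℝ) + 2 * s))⁻¹

/-- The squared norm `‖(-Δ)^(s/2) u‖²` in `L²(ℝᴺ)` of a function `u ∈ Hˢ(ℝᴺ)`, in its explicit form
`(C(N, s) / 2) ∫∫ |u(x) - u(y)|² / |x - y|^(N + 2s) dx dy`. -/
def fracLaplacianNormSq {N : ℕ} [NeZero N] (s : ℝ) (u : EuclideanSpace ℝ (Fin N) → ℝ) : ℝ :=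
  fracConst N s / 2 * (gagliardoSq s u).toReal

/-- The norm `‖u‖_s = (‖(-Δ)^(s/2) u‖² + ∫ V u²)^(1/2)` on `Hˢ(ℝᴺ)` given by the potential `V`. -/
def hsNorm {N : ℕ} [NeZero N] (V : EuclideanSpace ℝ (Fin N) → ℝ) (s : ℝ)
    (u : EuclideanSpace ℝ (Fin N) → ℝ) : ℝ :=
  Real.sqrt (fracLaplacianNormSq s u + ∫ x, V x * u x ^ 2)

/-- `g` is the weak partial derivative `∂ᵢ u` on `ℝᴺ`, tested against `C_c^∞(ℝᴺ)`
(used here for `u` and `g` in `L²`, so that all the integrals converge). -/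
def IsWeakPartialDeriv {N : ℕ} (i : Fin N) (u g : EuclideanSpace ℝ (Fin N) → ℝ) : Prop :=
  ∀ φ : EuclideanSpace ℝ (Fin N) → ℝ, ContDiff ℝ ∞ φ → HasCompactSupport φ →
    ∫ x, u x * fderiv ℝ φ x (EuclideanSpace.single i 1) = -∫ x, g x * φ x

/-- `u` belongs to the Sobolev space `H¹(ℝᴺ)`: `u` and its weak partial derivatives are in `L²`. -/
def MemH1 {N : ℕ} (u : EuclideanSpace ℝ (Fin N) → ℝ) : Prop :=
  MemLp u 2 volume ∧
    ∀ i : Fin N, ∃ g : EuclideanSpace ℝ (Fin N) → ℝ, MemLp g 2 volume ∧ IsWeakPartialDeriv i u g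

/-- `f k → g` in `L^q_loc(ℝᴺ)`: all the functions are in `L^q_loc`, and the convergence
is in `L^q(K)` for every compact `K`. -/
def TendstoLqLoc {N : ℕ} (q : ℝ) (f : ℕ → EuclideanSpace ℝ (Fin N) → ℝ)
    (g : EuclideanSpace ℝ (Fin N) → ℝ) : Prop :=
  ∀ K : Set (EuclideanSpace ℝ (Fin N)), IsCompact K →
    (∀ k, MemLp (f k) (ENNReal.ofReal q) (volume.restrict K)) ∧
    MemLp g (ENNReal.ofReal q) (volume.restrict K) ∧
    Tendsto (fun k => eLpNorm (f k - g) (ENNReal.ofReal q) (volume.restrict K)) atTop (𝓝 0)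

end FracSobolev

end

/-!
# Local compactness of sequences bounded in `H^{s_n}` as `s_n → 1`

The proof uses no Fourier transform; everything is expressed through the translation modulus
`diffSq u h = ‖u(· + h) - u‖²` in `L²`.

*Uniform modulus of continuity.* The bound on `‖v_n‖_s` controls `‖v_n‖²` because `V` is bounded
below, and `(1 - s) [v_n]_s²` because `C(N, s) ≥ c (1 - s)` (`exists_mul_le_fracConst`). The Gagliardo
seminorm is `∫ diffSq u h / ‖h‖ ^ (N + 2 s)`. Since `diffSq u (2 h) ≤ 4 diffSq u h`, the masses of the
dyadic shells in this integral decay at most like `4 ^ (-(1 - s) j)` towards the origin, so a single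
shell carries at most a fraction `O(1 - s)` of the total (`lintegral_shell_le`). Averaging
`diffSq u h ≤ 2 diffSq u k + 2 diffSq u (h - k)` over `k` in a ball inside one shell gives
`diffSq v_n h ≤ K ‖h‖ ^ (2 s_n)` with `K` independent of `n` (`diffSq_le_rpow_mul_gagliardoSq`). As
`s_n ≥ 1/2`, the sequence is bounded in `B^{1/2}_{2,∞}` (`BesovHalfBound`).

*Compactness.* A weak `L²` limit `w` of a subsequence inherits the bounds, by weak lower
semicontinuity. Means over balls of radius `r` converge pointwise and boundedly, and approximate the
functions up to `O(√r)` in `L²`, so the convergence is strong in `L²` on sets of finite measure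
(`tendsto_setLIntegral_sq`).

*Higher integrability.* Comparing `{|u| > 2 l}` with balls of twice the measure of `{|u| > l}` yields
`|{|u| > 2 l}| ≤ C l ^ (-2) |{|u| > l}| ^ (1 / N)`. Weak type `p` thus improves to weak type
`2 + p / N`, and iterating from `p = 2` approaches the fixed point `2 N / (N - 1)`
(`exists_uniformWeakType`). Interpolation with `L²` gives the convergence in `L^q_loc`.

*The limit is in `H¹`.* Letting `s_n → 1` in the modulus of continuity, `diffSq w h ≤ K ‖h‖ ^ 2`, so
difference quotients of `w` are bounded in `L²`, and their weak limits are weak derivatives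
(`exists_weak_directional_deriv`).
-/

set_option linter.unusedSectionVars false

namespace FracSobolev

open scoped NNReal

/-! ### The translation modulus and the Gagliardo seminorm -/

section Translation

variable {E : Type*} [NormedAddCommGroup E] [NormedSpace ℝ E] [FiniteDimensional ℝ E]
  [MeasureSpace E] [BorelSpace E] [(volume : Measure E).IsAddHaarMeasure]

/-- The squared `L²` translation modulus `h ↦ ‖u(· + h) - u‖²` of a function `u`. -/
noncomputable def diffSq (u : E → ℝ) (h : E) : ℝ≥0∞ := ∫⁻ x, ‖u (x + h) - u x‖ₑ ^ 2

lemma enorm_add_sq_le (a b : ℝ) : ‖a + b‖ₑ ^ 2 ≤ 2 * ‖a‖ₑ ^ 2 + 2 * ‖b‖ₑ ^ 2 := by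
  have h : (a + b) ^ 2 ≤ 2 * a ^ 2 + 2 * b ^ 2 := by nlinarith [sq_nonneg (a - b)]
  have e : ∀ c : ℝ, ‖c‖ₑ ^ 2 = ENNReal.ofReal (c ^ 2) := fun c => by
    rw [Real.enorm_eq_ofReal_abs, ← ENNReal.ofReal_pow (abs_nonneg c), sq_abs]
  rw [e, e, e, ← ENNReal.ofReal_ofNat, ← ENNReal.ofReal_mul (by norm_num),
    ← ENNReal.ofReal_mul (by norm_num), ← ENNReal.ofReal_add (by positivity) (by positivity)]
  exact ENNReal.ofReal_le_ofReal h

lemma measurable_diffSq {u : E → ℝ} (hu : Measurable u) : Measurable (diffSq u) := by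
  unfold diffSq
  exact Measurable.lintegral_prod_right' (f := fun p : E × E => ‖u (p.2 + p.1) - u p.2‖ₑ ^ 2)
    (by fun_prop)

lemma diffSq_add_le {u : E → ℝ} (hu : Measurable u) (h k : E) :
    diffSq u (h + k) ≤ 2 * diffSq u h + 2 * diffSq u k := by
  unfold diffSq
  rw [← lintegral_add_right_eq_self (fun x => ‖u (x + h) - u x‖ₑ ^ 2) k,
    ← lintegral_const_mul _ (by fun_prop), ← lintegral_const_mul _ (by fun_prop),
    ← lintegral_add_left (by fun_prop)]
  refine lintegral_mono fun x => ?_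
  have : u (x + (h + k)) - u x = (u (x + k + h) - u (x + k)) + (u (x + k) - u x) := by
    rw [show x + (h + k) = x + k + h by abel]; ring
  rw [this]
  exact enorm_add_sq_le _ _

lemma diffSq_sub_le {u w : E → ℝ} (hu : Measurable u) (h : E) :
    diffSq (fun x => u x - w x) h ≤ 2 * diffSq u h + 2 * diffSq w h := by
  unfold diffSq
  rw [← lintegral_const_mul _ (by fun_prop)]
  by_cases hw : (∫⁻ x, ‖w (x + h) - w x‖ₑ ^ 2) = ⊤
  · rw [hw]; simp
  rw [← lintegral_const_mul' _ _ (by norm_num), ← lintegral_add_left (by fun_prop)]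
  refine lintegral_mono fun x => ?_
  have : u (x + h) - w (x + h) - (u x - w x) = (u (x + h) - u x) + -(w (x + h) - w x) := by ring
  rw [this]
  exact (enorm_add_sq_le _ _).trans (by rw [enorm_neg])

lemma diffSq_le_four_mul {u : E → ℝ} (hu : Measurable u) (h : E) :
    diffSq u h ≤ 4 * ∫⁻ x, ‖u x‖ₑ ^ 2 := by
  have e : (4 : ℝ≥0∞) * ∫⁻ x, ‖u x‖ₑ ^ 2
      = 2 * (∫⁻ x, ‖u (x + h)‖ₑ ^ 2) + 2 * ∫⁻ x, ‖u x‖ₑ ^ 2 := by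
    rw [lintegral_add_right_eq_self (fun x => ‖u x‖ₑ ^ 2) h, ← add_mul]; norm_num
  rw [e, ← lintegral_const_mul _ (by fun_prop), ← lintegral_const_mul _ (by fun_prop),
    ← lintegral_add_left (by fun_prop)]
  refine lintegral_mono fun x => ?_
  rw [sub_eq_add_neg]
  exact (enorm_add_sq_le _ _).trans (by rw [enorm_neg])

/-- The spherical shell `t / 2 < ‖h‖ ≤ t`. -/
def shell (t : ℝ) : Set E := {h : E | t / 2 < ‖h‖ ∧ ‖h‖ ≤ t}

lemma measurableSet_shell (t : ℝ) : MeasurableSet (shell t : Set E) :=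
  (measurableSet_lt measurable_const measurable_norm).inter
    (measurableSet_le measurable_norm measurable_const)

lemma lintegral_comp_two_smul {g : E → ℝ≥0∞} (hg : Measurable g) :
    ∫⁻ h, g h = ENNReal.ofReal (2 ^ Module.finrank ℝ E) * ∫⁻ h, g ((2 : ℝ) • h) := by
  have := lintegral_map (μ := (volume : Measure E)) hg (measurable_const_smul (2 : ℝ))
  rw [← this, Measure.map_addHaar_smul _ two_ne_zero, lintegral_smul_measure, smul_eq_mul,
    ← mul_assoc, ← ENNReal.ofReal_mul (by positivity), abs_of_pos (by positivity),
    mul_inv_cancel₀ (by positivity)]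
  simp

/-- Doubling a shift multiplies the translation modulus by at most `4`; the weight
`‖h‖ ^ (-(d + 2 s))` and the volume element scale so that the mass of the shell of radius `t` is at
most `4 ^ (1 - s)` times the mass of the shell of radius `t / 2`. -/
lemma lintegral_shell_le_half {F : E → ℝ≥0∞} (hF : Measurable F)
    (hF2 : ∀ h, F ((2 : ℝ) • h) ≤ 4 * F h) (s t : ℝ) :
    ENNReal.ofReal (4 ^ (s - 1)) * ∫⁻ h in shell t,
        F h * ENNReal.ofReal (‖h‖ ^ (-((Module.finrank ℝ E : ℝ) + 2 * s)))
      ≤ ∫⁻ h in shell (t / 2),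
        F h * ENNReal.ofReal (‖h‖ ^ (-((Module.finrank ℝ E : ℝ) + 2 * s))) := by
  set d := Module.finrank ℝ E with hd
  rw [← lintegral_indicator (measurableSet_shell _), ← lintegral_indicator (measurableSet_shell _),
    lintegral_comp_two_smul (Measurable.indicator (by fun_prop) (measurableSet_shell _)),
    ← lintegral_const_mul' _ _ ENNReal.ofReal_ne_top,
    ← lintegral_const_mul' _ _ ENNReal.ofReal_ne_top]
  refine lintegral_mono fun h => ?_
  have hmem : (2 : ℝ) • h ∈ shell t ↔ h ∈ shell (t / 2) := by
    simp only [shell, Set.mem_ofPred_eq, norm_smul, Real.norm_ofNat]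
    constructor <;> rintro ⟨h1, h2⟩ <;> constructor <;> linarith
  by_cases hm : h ∈ shell (t / 2)
  · rw [Set.indicator_of_mem hm, Set.indicator_of_mem (hmem.2 hm)]
    have hw : ENNReal.ofReal (4 ^ (s - 1)) * (ENNReal.ofReal (2 ^ d) * (4 *
        ENNReal.ofReal (‖(2 : ℝ) • h‖ ^ (-((d : ℝ) + 2 * s)))))
        = ENNReal.ofReal (‖h‖ ^ (-((d : ℝ) + 2 * s))) := by
      rw [← ENNReal.ofReal_ofNat 4, ← ENNReal.ofReal_mul (by norm_num),
        ← ENNReal.ofReal_mul (by positivity), ← ENNReal.ofReal_mul (by positivity)]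
      congr 1
      rw [norm_smul, Real.norm_ofNat, Real.mul_rpow (by norm_num) (norm_nonneg _)]
      have : (4 : ℝ) ^ (s - 1) * (2 ^ d * (4 * 2 ^ (-((d : ℝ) + 2 * s)))) = 1 := by
        rw [show (4 : ℝ) = 2 ^ (2 : ℝ) by norm_num, ← Real.rpow_mul (by norm_num),
          ← Real.rpow_natCast, ← Real.rpow_add (by norm_num), ← Real.rpow_add (by norm_num),
          ← Real.rpow_add (by norm_num)]
        ring_nf
        simp
      linear_combination ‖h‖ ^ (-((d : ℝ) + 2 * s)) * this
    calc _ ≤ ENNReal.ofReal (4 ^ (s - 1)) * (ENNReal.ofReal (2 ^ d) * (4 * F h *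
        ENNReal.ofReal (‖(2 : ℝ) • h‖ ^ (-((d : ℝ) + 2 * s))))) := by gcongr; exact hF2 h
      _ = F h * (ENNReal.ofReal (4 ^ (s - 1)) * (ENNReal.ofReal (2 ^ d) * (4 *
        ENNReal.ofReal (‖(2 : ℝ) • h‖ ^ (-((d : ℝ) + 2 * s)))))) := by ring
      _ = _ := by rw [hw]
  · rw [Set.indicator_of_notMem (fun h' => hm (hmem.1 h'))]
    simp

lemma pairwise_disjoint_shell {t : ℝ} (ht : 0 < t) :
    Pairwise (Function.onFun Disjoint fun j : ℕ => (shell (t / 2 ^ j) : Set E)) := by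
  have key : ∀ i j : ℕ, i < j → Disjoint (shell (t / 2 ^ i) : Set E) (shell (t / 2 ^ j)) := by
    intro i j hij
    refine Set.disjoint_left.2 fun h h1 h2 => ?_
    have h3 : t / 2 ^ j ≤ t / 2 ^ i / 2 := by
      rw [div_div, ← pow_succ]
      exact div_le_div_of_nonneg_left ht.le (by positivity)
        (pow_le_pow_right₀ (by norm_num) hij)
    exact absurd (h1.1.trans_le h2.2) (not_lt.2 h3)
  intro i j hij
  rcases lt_or_gt_of_ne hij with h | h
  · exact key i j h
  · exact (key j i h).symm

lemma one_sub_four_rpow_le {s : ℝ} (hs : s < 1) : 1 - (4 : ℝ) ^ (s - 1) ≤ 2 * (1 - s) := by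
  have h4 : Real.log 4 ≤ 2 := by
    rw [show (4 : ℝ) = 2 ^ 2 by norm_num, Real.log_pow]
    have := Real.log_two_lt_d9
    push_cast; linarith
  rw [Real.rpow_def_of_pos (by norm_num)]
  nlinarith [Real.add_one_le_exp (Real.log 4 * (s - 1))]

/-- The masses of the shells of radii `t / 2 ^ j` decay at most like `4 ^ (-(1 - s) j)`, so each of
them carries at most a fraction `O(1 - s)` of the whole integral. -/
lemma lintegral_shell_le {F : E → ℝ≥0∞} (hF : Measurable F)
    (hF2 : ∀ h, F ((2 : ℝ) • h) ≤ 4 * F h) {s t : ℝ} (hs : s < 1) (ht : 0 < t) :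
    ∫⁻ h in shell t, F h * ENNReal.ofReal (‖h‖ ^ (-((Module.finrank ℝ E : ℝ) + 2 * s)))
      ≤ ENNReal.ofReal (2 * (1 - s)) *
        ∫⁻ h, F h * ENNReal.ofReal (‖h‖ ^ (-((Module.finrank ℝ E : ℝ) + 2 * s))) := by
  set G : E → ℝ≥0∞ := fun h =>
    F h * ENNReal.ofReal (‖h‖ ^ (-((Module.finrank ℝ E : ℝ) + 2 * s))) with hG
  set r := ENNReal.ofReal (4 ^ (s - 1)) with hr
  have hr1 : r < 1 := by
    rw [hr, ENNReal.ofReal_lt_one]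
    exact Real.rpow_lt_one_of_one_lt_of_neg (by norm_num) (by linarith)
  have hstep : ∀ j : ℕ, r ^ j * ∫⁻ h in shell t, G h ≤ ∫⁻ h in shell (t / 2 ^ j), G h := by
    intro j
    induction j with
    | zero => simp
    | succ j ih =>
      calc r ^ (j + 1) * ∫⁻ h in shell t, G h = r * (r ^ j * ∫⁻ h in shell t, G h) := by
            rw [pow_succ]; ring
        _ ≤ r * ∫⁻ h in shell (t / 2 ^ j), G h := by gcongr
        _ ≤ ∫⁻ h in shell (t / 2 ^ j / 2), G h := lintegral_shell_le_half hF hF2 s _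
        _ = _ := by rw [div_div, ← pow_succ]
  have hsum : (1 - r)⁻¹ * ∫⁻ h in shell t, G h ≤ ∫⁻ h, G h := by
    rw [← ENNReal.tsum_geometric, ← ENNReal.tsum_mul_right]
    calc _ ≤ ∑' j : ℕ, ∫⁻ h in shell (t / 2 ^ j), G h := ENNReal.tsum_le_tsum hstep
      _ = ∫⁻ h in ⋃ j : ℕ, shell (t / 2 ^ j), G h :=
          (lintegral_iUnion (fun j => measurableSet_shell _) (pairwise_disjoint_shell ht) _).symm
      _ ≤ _ := setLIntegral_le_lintegral _ _
  have h0 : 1 - r ≠ 0 := (tsub_pos_of_lt hr1).ne'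
  have h1 : 1 - r ≠ ⊤ := (tsub_le_self.trans_lt ENNReal.one_lt_top).ne
  calc ∫⁻ h in shell t, G h = (1 - r) * ((1 - r)⁻¹ * ∫⁻ h in shell t, G h) := by
        rw [← mul_assoc, ENNReal.mul_inv_cancel h0 h1, one_mul]
    _ ≤ (1 - r) * ∫⁻ h, G h := by gcongr
    _ ≤ _ := by
        gcongr
        rw [hr, ← ENNReal.ofReal_one, ← ENNReal.ofReal_sub _ (by positivity)]
        exact ENNReal.ofReal_le_ofReal (one_sub_four_rpow_le hs)

/-- If `F` is quasi-subadditive, then `F h` is controlled by its average over the points `k` near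
`h / 2`, since then `h - k` is near `h / 2` too. All these points lie in one shell, which carries
only a fraction `O(1 - s)` of the integral of `F h / ‖h‖ ^ (d + 2 s)`. -/
lemma pointwise_le_of_quasiSubadditive {F : E → ℝ≥0∞} (hF : Measurable F)
    (hadd : ∀ h k, F (h + k) ≤ 2 * F h + 2 * F k) {s : ℝ} (hs0 : 0 < s) (hs : s < 1)
    {h : E} (hh : h ≠ 0) :
    F h ≤ ENNReal.ofReal (8 * 8 ^ Module.finrank ℝ E * (1 - s) * ‖h‖ ^ (2 * s)) *
      (volume (Metric.ball (0 : E) 1))⁻¹ *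
      ∫⁻ k, F k * ENNReal.ofReal (‖k‖ ^ (-((Module.finrank ℝ E : ℝ) + 2 * s))) := by
  set d := Module.finrank ℝ E with hd
  set t := ‖h‖ with ht
  have ht0 : 0 < t := norm_pos_iff.2 hh
  set I := ∫⁻ k, F k * ENNReal.ofReal (‖k‖ ^ (-((d : ℝ) + 2 * s))) with hI
  set S := Metric.ball ((1 / 2 : ℝ) • h) (t / 8) with hS
  have hF2 : ∀ h, F ((2 : ℝ) • h) ≤ 4 * F h := fun h => by
    rw [two_smul]
    exact (hadd h h).trans (by rw [← add_mul]; norm_num)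
  have hnh : ‖(1 / 2 : ℝ) • h‖ = t / 2 := by
    rw [norm_smul, Real.norm_of_nonneg (by norm_num)]; ring
  have hSsub : S ⊆ shell (3 / 4 * t) := by
    intro k hk
    rw [hS, mem_ball_iff_norm] at hk
    have h1 := norm_sub_norm_le ((1 / 2 : ℝ) • h) k
    have h2 := norm_sub_norm_le k ((1 / 2 : ℝ) • h)
    rw [norm_sub_rev] at h1
    rw [hnh] at h1 h2
    exact ⟨by linarith, by linarith⟩
  have hvol : volume S = ENNReal.ofReal ((t / 8) ^ d) * volume (Metric.ball (0 : E) 1) :=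
    Measure.addHaar_ball_of_pos _ _ (by positivity)
  have hsymm : ∫⁻ k in S, F (h - k) = ∫⁻ k in S, F k := by
    have hmp := (Measure.measurePreserving_sub_left (volume : Measure E) h)
    rw [← hmp.setLIntegral_comp_preimage Metric.isOpen_ball.measurableSet hF]
    congr 2
    ext k
    simp only [hS, Set.mem_preimage, mem_ball_iff_norm]
    rw [← norm_neg]
    congr! 2
    module
  have hshell : ∫⁻ k in S, F k ≤ ENNReal.ofReal (t ^ ((d : ℝ) + 2 * s)) *
      (ENNReal.ofReal (2 * (1 - s)) * I) := by
    calc ∫⁻ k in S, F k ≤ ∫⁻ k in shell (3 / 4 * t), F k := lintegral_mono_set hSsub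
      _ ≤ ∫⁻ k in shell (3 / 4 * t), ENNReal.ofReal (t ^ ((d : ℝ) + 2 * s)) *
            (F k * ENNReal.ofReal (‖k‖ ^ (-((d : ℝ) + 2 * s)))) := by
          refine setLIntegral_mono' (measurableSet_shell _) fun k hk => ?_
          have hk0 : 0 < ‖k‖ := lt_of_le_of_lt (by positivity) hk.1
          have : 1 ≤ t ^ ((d : ℝ) + 2 * s) * ‖k‖ ^ (-((d : ℝ) + 2 * s)) := by
            rw [Real.rpow_neg hk0.le, ← div_eq_mul_inv, one_le_div (by positivity)]
            exact Real.rpow_le_rpow hk0.le (hk.2.trans (by linarith)) (by positivity)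
          calc F k = F k * 1 := (mul_one _).symm
            _ ≤ F k * ENNReal.ofReal (t ^ ((d : ℝ) + 2 * s) * ‖k‖ ^ (-((d : ℝ) + 2 * s))) := by
                gcongr
                rwa [ENNReal.one_le_ofReal]
            _ = _ := by rw [ENNReal.ofReal_mul (by positivity)]; ring
      _ = ENNReal.ofReal (t ^ ((d : ℝ) + 2 * s)) * ∫⁻ k in shell (3 / 4 * t),
            (F k * ENNReal.ofReal (‖k‖ ^ (-((d : ℝ) + 2 * s)))) :=
          lintegral_const_mul' _ _ ENNReal.ofReal_ne_top
      _ ≤ _ := by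
          gcongr
          exact lintegral_shell_le hF hF2 hs (by positivity)
  have hmain : F h * volume S ≤ 4 * ∫⁻ k in S, F k := by
    calc F h * volume S = ∫⁻ _ in S, F h := by rw [setLIntegral_const]
      _ ≤ ∫⁻ k in S, (2 * F k + 2 * F (h - k)) := by
          refine lintegral_mono fun k => ?_
          simpa using hadd k (h - k)
      _ = 4 * ∫⁻ k in S, F k := by
          rw [lintegral_add_left (by fun_prop), lintegral_const_mul _ hF,
            lintegral_const_mul _ (by fun_prop), hsymm, ← add_mul]
          norm_num
  have hS0 : volume S ≠ 0 := (Metric.measure_ball_pos _ _ (by positivity)).ne'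
  have hSt : volume S ≠ ⊤ := measure_ball_lt_top.ne
  have hB0 : volume (Metric.ball (0 : E) 1) ≠ 0 := (Metric.measure_ball_pos _ _ one_pos).ne'
  have hBt : volume (Metric.ball (0 : E) 1) ≠ ⊤ := measure_ball_lt_top.ne
  rw [← ENNReal.le_div_iff_mul_le (Or.inl hS0) (Or.inl hSt)] at hmain
  refine hmain.trans ?_
  rw [div_eq_mul_inv, hvol, ENNReal.mul_inv (Or.inr hBt) (Or.inr hB0),
    ← ENNReal.ofReal_inv_of_pos (by positivity)]
  calc _ ≤ 4 * (ENNReal.ofReal (t ^ ((d : ℝ) + 2 * s)) *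
      (ENNReal.ofReal (2 * (1 - s)) * I)) * (ENNReal.ofReal (((t / 8) ^ d)⁻¹) *
        (volume (Metric.ball (0 : E) 1))⁻¹) := by gcongr
    _ = (4 * (ENNReal.ofReal (t ^ ((d : ℝ) + 2 * s)) * (ENNReal.ofReal (2 * (1 - s)) *
      (ENNReal.ofReal (((t / 8) ^ d)⁻¹))))) * (volume (Metric.ball (0 : E) 1))⁻¹ * I := by ring
    _ = _ := by
      congr 2
      have h1s : 0 ≤ 2 * (1 - s) := by linarith
      rw [← ENNReal.ofReal_ofNat 4, ← ENNReal.ofReal_mul h1s,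
        ← ENNReal.ofReal_mul (by positivity), ← ENNReal.ofReal_mul (by norm_num)]
      congr 1
      rw [Real.rpow_add ht0, Real.rpow_natCast, div_pow]
      field_simp
      ring

end Translation

/-- In the variables `(x, h) = (x, y - x)` the Gagliardo seminorm is a weighted integral of the
translation modulus. -/
lemma gagliardoSq_eq_lintegral_diffSq {N : ℕ} (s : ℝ) {u : EuclideanSpace ℝ (Fin N) → ℝ}
    (hu : Measurable u) :
    gagliardoSq s u = ∫⁻ h, diffSq u h * ENNReal.ofReal (‖h‖ ^ (-((N : ℝ) + 2 * s))) := by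
  unfold gagliardoSq
  have e : ∀ x y : EuclideanSpace ℝ (Fin N),
      ENNReal.ofReal (|u x - u y| ^ 2 / ‖x - y‖ ^ ((N : ℝ) + 2 * s))
        = ‖u x - u y‖ₑ ^ 2 * ENNReal.ofReal (‖x - y‖ ^ (-((N : ℝ) + 2 * s))) := fun x y => by
    rw [Real.rpow_neg (norm_nonneg _), div_eq_mul_inv, ENNReal.ofReal_mul (by positivity),
      ENNReal.ofReal_pow (abs_nonneg _), Real.enorm_eq_ofReal_abs]
  simp_rw [e]
  rw [Measure.volume_eq_prod, lintegral_prod_symm' _ (by fun_prop)]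
  have e2 : ∀ y : EuclideanSpace ℝ (Fin N),
      ∫⁻ x, ‖u x - u y‖ₑ ^ 2 * ENNReal.ofReal (‖x - y‖ ^ (-((N : ℝ) + 2 * s)))
        = ∫⁻ h, ‖u (y + h) - u y‖ₑ ^ 2 * ENNReal.ofReal (‖h‖ ^ (-((N : ℝ) + 2 * s))) := fun y => by
    rw [← lintegral_add_left_eq_self _ y]
    simp
  simp_rw [e2]
  rw [lintegral_lintegral_swap (by fun_prop)]
  refine lintegral_congr fun h => ?_
  rw [lintegral_mul_const _ (by fun_prop)]
  rfl

/-- A function whose Gagliardo seminorm of order `s` is `O((1 - s) ^ (-1/2))` is `s`-Hölder in the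
`L²` sense, with a constant that stays bounded as `s → 1`. -/
lemma diffSq_le_rpow_mul_gagliardoSq {N : ℕ} {s : ℝ} (hs0 : 0 < s) (hs : s < 1)
    {u : EuclideanSpace ℝ (Fin N) → ℝ} (hu : Measurable u) (h : EuclideanSpace ℝ (Fin N)) :
    diffSq u h ≤ ENNReal.ofReal (‖h‖ ^ (2 * s)) * (ENNReal.ofReal (8 * 8 ^ N) *
      (volume (Metric.ball (0 : EuclideanSpace ℝ (Fin N)) 1))⁻¹ *
      (ENNReal.ofReal (1 - s) * gagliardoSq s u)) := by
  rcases eq_or_ne h 0 with rfl | hh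
  · simp [diffSq]
  have := pointwise_le_of_quasiSubadditive (measurable_diffSq hu) (diffSq_add_le hu) hs0 hs hh
  rw [finrank_euclideanSpace_fin, ← gagliardoSq_eq_lintegral_diffSq s hu,
    ENNReal.ofReal_mul (by nlinarith [pow_pos (show (0 : ℝ) < 8 by norm_num) N]),
    ENNReal.ofReal_mul (by positivity)] at this
  exact this.trans_eq (by ring)

/-! ### The normalizing constant as `s → 1` -/

/-- A radial majorant of the integrand defining `fracConst`. -/
noncomputable def symbolMajorant (a r : ℝ) : ℝ := if r ≤ 1 then r ^ (2 - a) else 2 * r ^ (-a)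

lemma symbol_le_majorant {N : ℕ} [NeZero N] (a : ℝ) (ζ : EuclideanSpace ℝ (Fin N)) (hζ : ζ ≠ 0) :
    (1 - Real.cos (ζ 0)) / ‖ζ‖ ^ a ≤ symbolMajorant a ‖ζ‖ := by
  have hp : 0 < ‖ζ‖ := norm_pos_iff.2 hζ
  unfold symbolMajorant
  split_ifs with h
  · rw [Real.rpow_sub hp]
    gcongr
    have h1 := Real.one_sub_sq_div_two_le_cos (x := ζ 0)
    have h2 : (ζ 0) ^ 2 ≤ ‖ζ‖ ^ 2 := by
      rw [← sq_abs, ← Real.norm_eq_abs]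
      have := PiLp.norm_apply_le ζ (0 : Fin N)
      gcongr
    rw [Real.rpow_two]
    nlinarith [sq_nonneg ‖ζ‖]
  · rw [Real.rpow_neg hp.le, div_eq_mul_inv]
    gcongr
    linarith [Real.neg_one_le_cos (ζ 0)]

lemma integrableOn_majorant {n : ℕ} (hn : n ≠ 0) {s : ℝ} (hs : 1 / 2 < s) (hs1 : s < 1) :
    IntegrableOn (fun r : ℝ => r ^ (n - 1) • symbolMajorant (n + 2 * s) r) (Set.Ioi 0) ∧
    ∫ r in Set.Ioi (0 : ℝ), r ^ (n - 1) • symbolMajorant (n + 2 * s) r ≤ 2 / (1 - s) := by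
  have hpow : ∀ r : ℝ, 0 < r → r ^ (n - 1) = r ^ ((n : ℝ) - 1) := fun r hr => by
    rw [← Real.rpow_natCast, Nat.cast_sub (Nat.one_le_iff_ne_zero.2 hn)]; simp
  have e1 : Set.EqOn (fun r : ℝ => r ^ (n - 1) • symbolMajorant (n + 2 * s) r)
      (fun r => r ^ (1 - 2 * s)) (Set.Ioc 0 1) := fun r hr => by
    simp only [symbolMajorant, if_pos hr.2, smul_eq_mul]
    rw [hpow r hr.1, ← Real.rpow_add hr.1]
    ring_nf
  have e2 : Set.EqOn (fun r : ℝ => r ^ (n - 1) • symbolMajorant (n + 2 * s) r)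
      (fun r => 2 * r ^ (-1 - 2 * s)) (Set.Ioi 1) := fun r hr => by
    have hr0 : (0 : ℝ) < r := one_pos.trans hr
    simp only [symbolMajorant, if_neg (not_le.2 (Set.mem_Ioi.1 hr)), smul_eq_mul]
    rw [hpow r hr0, mul_left_comm, ← Real.rpow_add hr0]
    ring_nf
  have i1 : IntegrableOn (fun r : ℝ => r ^ (1 - 2 * s)) (Set.Ioc 0 1) := by
    rw [← intervalIntegrable_iff_integrableOn_Ioc_of_le zero_le_one]
    exact intervalIntegral.intervalIntegrable_rpow' (by linarith)
  have i2 : IntegrableOn (fun r : ℝ => 2 * r ^ (-1 - 2 * s)) (Set.Ioi 1) :=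
    (integrableOn_Ioi_rpow_of_lt (by linarith) one_pos).const_mul 2
  have i1' := (integrableOn_congr_fun e1 measurableSet_Ioc).2 i1
  have i2' := (integrableOn_congr_fun e2 measurableSet_Ioi).2 i2
  have hU : Set.Ioi (0 : ℝ) = Set.Ioc 0 1 ∪ Set.Ioi 1 :=
    (Set.Ioc_union_Ioi_eq_Ioi zero_le_one).symm
  refine ⟨hU ▸ i1'.union i2', ?_⟩
  rw [hU, setIntegral_union Set.Ioc_disjoint_Ioi_same measurableSet_Ioi i1' i2',
    setIntegral_congr_fun measurableSet_Ioc e1, setIntegral_congr_fun measurableSet_Ioi e2,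
    ← intervalIntegral.integral_of_le zero_le_one, integral_rpow (Or.inl (by linarith)),
    integral_const_mul, integral_Ioi_rpow_of_lt (by linarith) one_pos]
  have h1 : 0 < 1 - s := by linarith
  rw [Real.one_rpow, Real.one_rpow, Real.zero_rpow (by linarith),
    show 1 - 2 * s + 1 = 2 * (1 - s) by ring, show -1 - 2 * s + 1 = -(2 * s) by ring, neg_div_neg_eq]
  have h2 : 1 / (2 * s) ≤ 1 := by rw [div_le_one (by linarith)]; linarith
  have h3 : 2 * (1 / (2 * s)) ≤ 1 / (1 - s) := by
    rw [le_div_iff₀ h1]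
    nlinarith [div_pos one_pos (show 0 < 2 * s by linarith)]
  have h4 : (1 - 0) / (2 * (1 - s)) ≤ 1 / (1 - s) := by
    rw [sub_zero]
    gcongr
    linarith
  calc _ ≤ 1 / (1 - s) + 1 / (1 - s) := add_le_add h4 h3
    _ = 2 / (1 - s) := by ring

/-- The normalizing constant `C(N, s)` does not vanish faster than `1 - s` as `s → 1`. -/
lemma exists_mul_le_fracConst (N : ℕ) [NeZero N] :
    ∃ c : ℝ, 0 < c ∧ ∀ s : ℝ, 1 / 2 < s → s < 1 → c * (1 - s) ≤ fracConst N s := by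
  have hN : N ≠ 0 := NeZero.ne N
  have : Nontrivial (EuclideanSpace ℝ (Fin N)) := by
    have : Nonempty (Fin N) := ⟨0⟩
    infer_instance
  set b := (volume : Measure (EuclideanSpace ℝ (Fin N))).real (Metric.ball 0 1) with hb
  have hb0 : 0 < b := ENNReal.toReal_pos (Metric.measure_ball_pos _ _ one_pos).ne'
    measure_ball_lt_top.ne
  have hN0 : (0 : ℝ) < N := by exact_mod_cast Nat.pos_of_ne_zero hN
  refine ⟨(N * b * 2)⁻¹, by positivity, fun s hs hs1 => ?_⟩
  set f : EuclideanSpace ℝ (Fin N) → ℝ := fun ζ => (1 - Real.cos (ζ 0)) / ‖ζ‖ ^ ((N : ℝ) + 2 * s) with hf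
  set g : EuclideanSpace ℝ (Fin N) → ℝ := fun ζ => symbolMajorant ((N : ℝ) + 2 * s) ‖ζ‖ with hg
  have hf0 : ∀ ζ, 0 ≤ f ζ := fun ζ =>
    div_nonneg (sub_nonneg.2 (Real.cos_le_one _)) (Real.rpow_nonneg (norm_nonneg _) _)
  have hfg : ∀ᵐ ζ : EuclideanSpace ℝ (Fin N), f ζ ≤ g ζ := by
    have h0 : ∀ᵐ ζ : EuclideanSpace ℝ (Fin N), ζ ≠ 0 := compl_mem_ae_iff.2 (measure_singleton 0)
    filter_upwards [h0] with ζ hζ using symbol_le_majorant _ ζ hζ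
  obtain ⟨hmi, hmb⟩ := integrableOn_majorant hN hs hs1
  have hgi : Integrable g := by
    rw [hg, integrable_fun_norm_addHaar volume (f := symbolMajorant ((N : ℝ) + 2 * s)),
      finrank_euclideanSpace_fin]
    exact hmi
  have hgI : ∫ ζ, g ζ ≤ N * b * 2 / (1 - s) := by
    rw [hg, integral_fun_norm_addHaar volume (symbolMajorant ((N : ℝ) + 2 * s)),
      finrank_euclideanSpace_fin, ← hb, nsmul_eq_mul, smul_eq_mul]
    calc _ ≤ N * b * (2 / (1 - s)) := by rw [mul_assoc]; gcongr
      _ = _ := by ring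
  have hfm : AEStronglyMeasurable f volume := by
    have : Measurable f := by fun_prop
    exact this.aestronglyMeasurable
  have hfi : Integrable f := hgi.mono' hfm (by
    filter_upwards [hfg] with ζ hζ
    rwa [Real.norm_of_nonneg (hf0 ζ)])
  have hfI : ∫ ζ, f ζ ≤ N * b * 2 / (1 - s) := (integral_mono_ae hfi hgi hfg).trans hgI
  have hpos : 0 < ∫ ζ, f ζ := by
    rw [integral_pos_iff_support_of_nonneg hf0 hfi]
    have hcont : Continuous fun ζ : EuclideanSpace ℝ (Fin N) => ζ 0 := by fun_prop
    have hopen : IsOpen {ζ : EuclideanSpace ℝ (Fin N) | 0 < ζ 0 ∧ ζ 0 < 1} :=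
      (isOpen_lt continuous_const hcont).inter (isOpen_lt hcont continuous_const)
    refine (hopen.measure_pos volume ⟨EuclideanSpace.single 0 (1 / 2), ?_⟩).trans_le
      (measure_mono ?_)
    · simp; norm_num
    · intro ζ hζ
      have hζ0 : ζ ≠ 0 := by rintro rfl; simp at hζ
      have hc : Real.cos (ζ 0) < 1 := by
        rw [← Real.cos_zero]
        exact Real.cos_lt_cos_of_nonneg_of_le_pi le_rfl
          (hζ.2.le.trans (by linarith [Real.pi_gt_three])) hζ.1
      exact (div_pos (sub_pos.2 hc) (Real.rpow_pos_of_pos (norm_pos_iff.2 hζ0) _)).ne'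
  have h1 : 0 < 1 - s := by linarith
  calc (N * b * 2)⁻¹ * (1 - s) = (N * b * 2 / (1 - s))⁻¹ := by
        rw [inv_div, div_eq_inv_mul]
    _ ≤ (∫ ζ, f ζ)⁻¹ := by gcongr
    _ = fracConst N s := rfl

/-! ### Superlevel sets and higher integrability -/

section LevelSets

variable {E : Type*} [NormedAddCommGroup E] [NormedSpace ℝ E] [FiniteDimensional ℝ E]
  [MeasureSpace E] [BorelSpace E] [(volume : Measure E).IsAddHaarMeasure]

/-- A measurable function `u` with `‖u‖² ≤ K` and `‖u(· + h) - u‖² ≤ K ‖h‖` in `L²`, that is, a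
bounded element of the Besov space `B^{1/2}_{2,∞}`. -/
structure BesovHalfBound (K : ℝ≥0) (u : E → ℝ) : Prop where
  measurable : Measurable u
  lintegral_sq_le : ∫⁻ x, ‖u x‖ₑ ^ 2 ≤ K
  diffSq_le : ∀ h, diffSq u h ≤ K * ENNReal.ofReal ‖h‖

lemma BesovHalfBound.sub {K : ℝ≥0} {u w : E → ℝ} (hu : BesovHalfBound K u)
    (hw : BesovHalfBound K w) : BesovHalfBound (4 * K) (fun x => u x - w x) where
  measurable := hu.measurable.sub hw.measurable
  lintegral_sq_le := by
    have hm := hu.measurable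
    have hm' := hw.measurable
    calc ∫⁻ x, ‖u x - w x‖ₑ ^ 2 ≤ ∫⁻ x, (2 * ‖u x‖ₑ ^ 2 + 2 * ‖w x‖ₑ ^ 2) := by
          refine lintegral_mono fun x => ?_
          rw [sub_eq_add_neg]
          exact (enorm_add_sq_le _ _).trans (by rw [enorm_neg])
      _ = 2 * (∫⁻ x, ‖u x‖ₑ ^ 2) + 2 * ∫⁻ x, ‖w x‖ₑ ^ 2 := by
          rw [lintegral_add_left (by fun_prop), lintegral_const_mul _ (by fun_prop),
            lintegral_const_mul _ (by fun_prop)]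
      _ ≤ 2 * K + 2 * K := by gcongr; exacts [hu.lintegral_sq_le, hw.lintegral_sq_le]
      _ = _ := by push_cast; ring
  diffSq_le h := by
    calc _ ≤ 2 * diffSq u h + 2 * diffSq w h := diffSq_sub_le hu.measurable h
      _ ≤ 2 * (K * ENNReal.ofReal ‖h‖) + 2 * (K * ENNReal.ofReal ‖h‖) := by
          gcongr; exacts [hu.diffSq_le h, hw.diffSq_le h]
      _ = _ := by push_cast; ring

/-- If the ball of radius `r` has at least twice the measure of `{|u| > l}`, then every point of
`{|u| > 2l}` sees the set `{|u| ≤ l}` in at least half of the ball of radius `r` around it, and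
`u` jumps by at least `l` there. -/
lemma measure_superlevel_two_mul_le {K : ℝ≥0} {u : E → ℝ} (hu : BesovHalfBound K u)
    {l r : ℝ} (hl : 0 < l) (hr : 0 < r)
    (hlr : 2 * volume {x | l < |u x|} ≤ volume (Metric.ball (0 : E) r)) :
    ENNReal.ofReal (l ^ 2) * volume {x | 2 * l < |u x|} ≤ 2 * (K * ENNReal.ofReal r) := by
  have hm := hu.measurable
  set B := Metric.ball (0 : E) r with hB
  set S : Set E := {x | l < |u x|} with hS
  have hSm : MeasurableSet S := measurableSet_lt measurable_const (by fun_prop)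
  have hB0 : volume B ≠ 0 := (Metric.measure_ball_pos _ _ hr).ne'
  have hBt : volume B ≠ ⊤ := measure_ball_lt_top.ne
  have hupper : ∫⁻ h in B, diffSq u h ≤ K * ENNReal.ofReal r * volume B := by
    calc ∫⁻ h in B, diffSq u h ≤ ∫⁻ _ in B, K * ENNReal.ofReal r := by
          refine setLIntegral_mono' Metric.isOpen_ball.measurableSet fun h hh => ?_
          refine (hu.diffSq_le h).trans ?_
          gcongr
          exact (mem_ball_zero_iff.1 hh).le
      _ = _ := by rw [setLIntegral_const]
  have hpt : ∀ x ∈ {x | 2 * l < |u x|},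
      ENNReal.ofReal (l ^ 2) * (volume B / 2) ≤ ∫⁻ h in B, ‖u (x + h) - u x‖ₑ ^ 2 := by
    intro x hx
    have hTm : MeasurableSet ((fun h => x + h) ⁻¹' S) := measurable_const_add x hSm
    have hT : volume ((fun h => x + h) ⁻¹' S) = volume S := measure_preimage_add _ _ _
    have hhalf : volume B / 2 ≤ volume (B \ ((fun h => x + h) ⁻¹' S)) := by
      refine le_trans ?_ le_measure_sdiff
      rw [hT]
      refine ENNReal.le_sub_of_add_le_right ?_ ?_
      · exact ((le_mul_of_one_le_left (zero_le) one_le_two).trans_lt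
          (hlr.trans_lt hBt.lt_top)).ne
      · calc volume B / 2 + volume S ≤ volume B / 2 + volume B / 2 := by
              gcongr
              rw [ENNReal.le_div_iff_mul_le (Or.inl two_ne_zero) (Or.inl (by norm_num)), mul_comm]
              exact hlr
          _ = _ := ENNReal.add_halves _
    calc _ ≤ ENNReal.ofReal (l ^ 2) * volume (B \ ((fun h => x + h) ⁻¹' S)) := by gcongr
      _ = ∫⁻ _ in B \ ((fun h => x + h) ⁻¹' S), ENNReal.ofReal (l ^ 2) := by
          rw [setLIntegral_const]
      _ ≤ ∫⁻ h in B \ ((fun h => x + h) ⁻¹' S), ‖u (x + h) - u x‖ₑ ^ 2 := by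
          refine setLIntegral_mono' (Metric.isOpen_ball.measurableSet.diff hTm) fun h hh => ?_
          have h1 : |u (x + h)| ≤ l := not_lt.1 hh.2
          have h2 : 2 * l < |u x| := hx
          have h3 : l ≤ |u (x + h) - u x| := by
            have := abs_sub_abs_le_abs_sub (u x) (u (x + h))
            rw [abs_sub_comm] at this
            linarith
          rw [Real.enorm_eq_ofReal_abs, ← ENNReal.ofReal_pow (abs_nonneg _)]
          gcongr
      _ ≤ _ := lintegral_mono_set Set.sdiff_subset
  have hlower : ENNReal.ofReal (l ^ 2) * (volume B / 2) * volume {x | 2 * l < |u x|}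
      ≤ ∫⁻ h in B, diffSq u h := by
    calc _ = ∫⁻ _ in {x | 2 * l < |u x|}, ENNReal.ofReal (l ^ 2) * (volume B / 2) := by
          rw [setLIntegral_const]
      _ ≤ ∫⁻ x in {x | 2 * l < |u x|}, ∫⁻ h in B, ‖u (x + h) - u x‖ₑ ^ 2 :=
          setLIntegral_mono' (measurableSet_lt measurable_const (by fun_prop)) hpt
      _ ≤ ∫⁻ x, ∫⁻ h in B, ‖u (x + h) - u x‖ₑ ^ 2 := setLIntegral_le_lintegral _ _
      _ = _ := by
          unfold diffSq
          rw [lintegral_lintegral_swap (by fun_prop)]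
  have := hlower.trans hupper
  rw [← ENNReal.mul_le_mul_iff_left hB0 hBt]
  calc _ = 2 * (ENNReal.ofReal (l ^ 2) * (volume B / 2) * volume {x | 2 * l < |u x|}) := by
        have : 2 * (volume B / 2) = volume B := ENNReal.mul_div_cancel two_ne_zero (by norm_num)
        calc _ = ENNReal.ofReal (l ^ 2) * (2 * (volume B / 2)) * volume {x | 2 * l < |u x|} := by
              rw [this]; ring
          _ = _ := by ring
    _ ≤ 2 * (K * ENNReal.ofReal r * volume B) := by gcongr
    _ = _ := by ring

/-- The weak-type bound `|{|u| > l}| ≤ A l ^ (-p)`, uniformly over all `u` with the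
given bound in `B^{1/2}_{2,∞}`. -/
def UniformWeakType (E : Type*) [NormedAddCommGroup E] [MeasureSpace E] (K : ℝ≥0) (p : ℝ) : Prop :=
  ∃ A : ℝ, 0 < A ∧ ∀ u : E → ℝ, BesovHalfBound K u → ∀ l : ℝ, 0 < l →
    volume {x | l < |u x|} ≤ ENNReal.ofReal (A * l ^ (-p))

lemma uniformWeakType_two (K : ℝ≥0) : UniformWeakType E K 2 := by
  refine ⟨K + 1, by positivity, fun u hu l hl => ?_⟩
  have hm := hu.measurable
  have h1 := mul_meas_ge_le_lintegral (μ := (volume : Measure E))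
    (f := fun x => ‖u x‖ₑ ^ 2) (by fun_prop) (ENNReal.ofReal (l ^ 2))
  have h2 : {x | l < |u x|} ⊆ {x | ENNReal.ofReal (l ^ 2) ≤ ‖u x‖ₑ ^ 2} := by
    intro x hx
    have hx' : l < |u x| := hx
    show ENNReal.ofReal (l ^ 2) ≤ ‖u x‖ₑ ^ 2
    rw [Real.enorm_eq_ofReal_abs, ← ENNReal.ofReal_pow (abs_nonneg _)]
    gcongr
  have h0 : 0 < l ^ 2 := by positivity
  calc _ ≤ volume {x | ENNReal.ofReal (l ^ 2) ≤ ‖u x‖ₑ ^ 2} := measure_mono h2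
    _ ≤ (K : ℝ≥0∞) / ENNReal.ofReal (l ^ 2) := by
        rw [ENNReal.le_div_iff_mul_le (Or.inl (by simpa using h0.ne')) (Or.inl ENNReal.ofReal_ne_top),
          mul_comm]
        exact h1.trans hu.lintegral_sq_le
    _ = ENNReal.ofReal (K * l ^ (-2 : ℝ)) := by
        rw [Real.rpow_neg hl.le, Real.rpow_two, ← div_eq_mul_inv, ENNReal.ofReal_div_of_pos h0,
          ENNReal.ofReal_coe_nnreal]
    _ ≤ _ := by gcongr; simp

lemma UniformWeakType.step {K : ℝ≥0} {p : ℝ} (h : UniformWeakType E K p)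
    (hd : Module.finrank ℝ E ≠ 0) :
    UniformWeakType E K (2 + p / Module.finrank ℝ E) := by
  obtain ⟨A, hA, h⟩ := h
  set d := Module.finrank ℝ E with hdd
  have hd0 : (d : ℝ) ≠ 0 := by exact_mod_cast hd
  set b := (volume : Measure E).real (Metric.ball 0 1) with hb
  have hb0 : 0 < b := ENNReal.toReal_pos (Metric.measure_ball_pos _ _ one_pos).ne'
    measure_ball_lt_top.ne
  set c := (2 * A / b) ^ (1 / (d : ℝ)) with hc
  have hc0 : 0 < c := by positivity
  refine ⟨(2 * K * c + 1) * 2 ^ (2 + p / d), by positivity, fun u hu l hl => ?_⟩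
  -- `m` is the lower level; `r` is chosen so that the ball of radius `r` has measure `2 A m ^ (-p)`
  obtain ⟨m, hm0, rfl⟩ : ∃ m, 0 < m ∧ l = 2 * m := ⟨l / 2, by positivity, by ring⟩
  set r := c * m ^ (-(p / d)) with hr
  have hr0 : 0 < r := by positivity
  have hrd : r ^ d * b = 2 * (A * m ^ (-p)) := by
    rw [hr, mul_pow, hc, ← Real.rpow_natCast, ← Real.rpow_natCast, ← Real.rpow_mul (by positivity),
      ← Real.rpow_mul hm0.le, one_div_mul_cancel hd0, Real.rpow_one,
      show -(p / d) * (d : ℝ) = -p by field_simp]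
    field_simp
  have hball : volume (Metric.ball (0 : E) r) = ENNReal.ofReal (2 * (A * m ^ (-p))) := by
    rw [Measure.addHaar_ball_of_pos _ _ hr0, ← hrd, ENNReal.ofReal_mul (by positivity), hb,
      ofReal_measureReal measure_ball_lt_top.ne]
  have key := measure_superlevel_two_mul_le hu hm0 hr0 (by
    rw [hball, ENNReal.ofReal_mul (by norm_num), ENNReal.ofReal_ofNat]
    gcongr
    exact h u hu m hm0)
  have hm2 : 0 < m ^ 2 := by positivity
  calc volume {x | 2 * m < |u x|}
      ≤ 2 * (K * ENNReal.ofReal r) / ENNReal.ofReal (m ^ 2) := by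
        rw [ENNReal.le_div_iff_mul_le (Or.inl (by simpa using hm2.ne'))
          (Or.inl ENNReal.ofReal_ne_top), mul_comm]
        exact key
    _ = ENNReal.ofReal (2 * (K * r) / m ^ 2) := by
        rw [ENNReal.ofReal_div_of_pos hm2, ENNReal.ofReal_mul (p := 2) (by norm_num),
          ENNReal.ofReal_mul (p := (K : ℝ)) K.coe_nonneg, ENNReal.ofReal_coe_nnreal, ENNReal.ofReal_ofNat]
    _ ≤ _ := by
        refine ENNReal.ofReal_le_ofReal ?_
        have e : 2 * (K * r) / m ^ 2 = 2 * K * c * m ^ (-(2 + p / d)) := by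
          rw [hr, neg_add, Real.rpow_add hm0, Real.rpow_neg hm0.le 2, Real.rpow_two]
          field_simp
        have e2 : (2 * K * c + 1) * 2 ^ (2 + p / d) * (2 * m) ^ (-(2 + p / d))
            = (2 * K * c + 1) * m ^ (-(2 + p / d)) := by
          rw [Real.mul_rpow (by norm_num) hm0.le, Real.rpow_neg (by norm_num : (0 : ℝ) ≤ 2)]
          field_simp
        rw [e, e2]
        gcongr
        simp

/-- Iterating `p ↦ 2 + p / d` from `p = 2` brings `p` arbitrarily close to the fixed point
`2 d / (d - 1)`. -/
lemma exists_uniformWeakType (K : ℝ≥0) (hd : 2 ≤ Module.finrank ℝ E) {q : ℝ}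
    (hq : q < 2 * Module.finrank ℝ E / (Module.finrank ℝ E - 1)) :
    ∃ p, q < p ∧ UniformWeakType E K p := by
  set d := Module.finrank ℝ E with hdd
  have hd2 : (2 : ℝ) ≤ d := by exact_mod_cast hd
  have hd1 : (d : ℝ) - 1 ≠ 0 := by linarith
  set P : ℝ := 2 * d / (d - 1) with hP
  have hfix : 2 + P / d = P := by
    rw [hP]; field_simp; ring
  have hiter : ∀ j : ℕ, UniformWeakType E K (P + (2 - P) * (1 / d) ^ j) := by
    intro j
    induction j with
    | zero => simpa using uniformWeakType_two K
    | succ j ih =>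
      have := ih.step (by omega)
      rw [← hdd] at this
      convert this using 1
      rw [add_div, ← add_assoc, hfix, pow_succ]
      ring
  have hlim : Tendsto (fun j : ℕ => P + (2 - P) * (1 / (d : ℝ)) ^ j) atTop (𝓝 (P + (2 - P) * 0)) :=
    ((tendsto_pow_atTop_nhds_zero_of_lt_one (by positivity)
      (by rw [div_lt_one (by linarith)]; linarith)).const_mul _).const_add _
  rw [mul_zero, add_zero] at hlim
  obtain ⟨j, hj⟩ := (hlim.eventually (lt_mem_nhds hq)).exists
  exact ⟨_, hj, hiter j⟩

/-- Boundedness in `B^{1/2}_{2,∞}` controls the `L^q` norms on sets of finite measure for `q` below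
the critical exponent `2 d / (d - 1)`. -/
lemma exists_setLIntegral_rpow_le (K : ℝ≥0) (hd : 2 ≤ Module.finrank ℝ E) {q : ℝ} (hq0 : 0 < q)
    (hq : q < 2 * Module.finrank ℝ E / (Module.finrank ℝ E - 1)) {S : Set E}
    (hS : volume S ≠ ⊤) :
    ∃ M : ℝ≥0∞, M ≠ ⊤ ∧ ∀ u : E → ℝ, BesovHalfBound K u → ∫⁻ x in S, ‖u x‖ₑ ^ q ≤ M := by
  obtain ⟨p, hqp, A, hA, hw⟩ := exists_uniformWeakType K hd hq
  have i1 : IntegrableOn (fun t : ℝ => t ^ (q - 1)) (Set.Ioc 0 1) := by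
    rw [← intervalIntegrable_iff_integrableOn_Ioc_of_le zero_le_one]
    exact intervalIntegral.intervalIntegrable_rpow' (by linarith)
  have i2 : IntegrableOn (fun t : ℝ => A * t ^ (q - 1 - p)) (Set.Ioi 1) :=
    (integrableOn_Ioi_rpow_of_lt (by linarith) one_pos).const_mul A
  refine ⟨ENNReal.ofReal q * ((volume S * ∫⁻ t in Set.Ioc (0 : ℝ) 1, ENNReal.ofReal (t ^ (q - 1))) +
    ∫⁻ t in Set.Ioi (1 : ℝ), ENNReal.ofReal (A * t ^ (q - 1 - p))), ?_, fun u hu => ?_⟩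
  · exact ENNReal.mul_ne_top ENNReal.ofReal_ne_top (ENNReal.add_ne_top.2
      ⟨ENNReal.mul_ne_top hS i1.lintegral_lt_top.ne, i2.lintegral_lt_top.ne⟩)
  have hm := hu.measurable
  have e : ∀ x, ‖u x‖ₑ ^ q = ENNReal.ofReal (|u x| ^ q) := fun x => by
    rw [Real.enorm_eq_ofReal_abs, ENNReal.ofReal_rpow_of_nonneg (abs_nonneg _) hq0.le]
  simp_rw [e]
  rw [lintegral_rpow_eq_lintegral_meas_lt_mul _ (ae_of_all _ fun x => abs_nonneg (u x))
    (by fun_prop) hq0, ← Set.Ioc_union_Ioi_eq_Ioi (zero_le_one' ℝ),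
    lintegral_union measurableSet_Ioi Set.Ioc_disjoint_Ioi_same]
  gcongr ENNReal.ofReal q * (?_ + ?_)
  · rw [← lintegral_const_mul' _ _ hS]
    refine lintegral_mono fun t => ?_
    refine mul_le_mul' ?_ le_rfl
    exact (measure_mono (Set.subset_univ _)).trans_eq (Measure.restrict_apply_univ S)
  · refine setLIntegral_mono' measurableSet_Ioi fun t ht => ?_
    have ht0 : 0 < t := one_pos.trans ht
    calc _ ≤ ENNReal.ofReal (A * t ^ (-p)) * ENNReal.ofReal (t ^ (q - 1)) := by
          gcongr
          exact (Measure.restrict_apply_le _ _).trans (hw u hu t ht0)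
      _ = _ := by
          rw [← ENNReal.ofReal_mul (by positivity), mul_assoc, ← Real.rpow_add ht0]
          ring_nf

/-- For functions that are uniformly bounded in `B^{1/2}_{2,∞}`, convergence to `0` in `L²(S)`
self-improves to `L^q(S)`. -/
lemma tendsto_setLIntegral_rpow {K : ℝ≥0} (hd : 2 ≤ Module.finrank ℝ E) {q : ℝ} (hq0 : 2 ≤ q)
    (hq : q < 2 * Module.finrank ℝ E / (Module.finrank ℝ E - 1)) {S : Set E}
    (hS : volume S ≠ ⊤) {f : ℕ → E → ℝ} (hf : ∀ k, BesovHalfBound K (f k))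
    (h2 : Tendsto (fun k => ∫⁻ x in S, ‖f k x‖ₑ ^ 2) atTop (𝓝 0)) :
    Tendsto (fun k => ∫⁻ x in S, ‖f k x‖ₑ ^ q) atTop (𝓝 0) := by
  obtain ⟨q', hqq, hq'⟩ := exists_between hq
  obtain ⟨M, hM, hb⟩ := exists_setLIntegral_rpow_le K hd (by linarith) hq' hS
  set a := (q' - q) / (q' - 2) with ha
  have hq2 : 0 < q' - 2 := by linarith
  have ha0 : 0 < a := div_pos (by linarith) hq2
  have ha1 : 0 ≤ 1 - a := by
    rw [ha, sub_nonneg, div_le_one hq2]; linarith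
  have hexp : 2 * a + q' * (1 - a) = q := by
    rw [ha]; field_simp; ring
  have hlim : Tendsto (fun k => (∫⁻ x in S, ‖f k x‖ₑ ^ 2) ^ a * M ^ (1 - a)) atTop (𝓝 0) := by
    have := ENNReal.Tendsto.mul_const (h2.ennrpow_const a) (b := M ^ (1 - a))
      (Or.inr (ENNReal.rpow_ne_top_of_nonneg ha1 hM))
    rwa [ENNReal.zero_rpow_of_pos ha0, zero_mul] at this
  refine tendsto_of_tendsto_of_tendsto_of_le_of_le tendsto_const_nhds hlim
    (fun _ => zero_le) fun k => ?_
  have hm := (hf k).measurable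
  calc ∫⁻ x in S, ‖f k x‖ₑ ^ q
      = ∫⁻ x in S, (‖f k x‖ₑ ^ 2) ^ a * (‖f k x‖ₑ ^ q') ^ (1 - a) := by
        refine lintegral_congr fun x => ?_
        rw [← ENNReal.rpow_two, ← ENNReal.rpow_mul, ← ENNReal.rpow_mul,
          ← ENNReal.rpow_add_of_nonneg _ _ (by positivity) (mul_nonneg (by linarith) ha1), hexp]
    _ ≤ (∫⁻ x in S, ‖f k x‖ₑ ^ 2) ^ a * (∫⁻ x in S, ‖f k x‖ₑ ^ q') ^ (1 - a) :=
        ENNReal.lintegral_mul_norm_pow_le (by fun_prop) (by fun_prop) ha0.le ha1 (by ring)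
    _ ≤ _ := by gcongr; exact hb _ (hf k)

end LevelSets

/-! ### Weak limits and strong local convergence in `L²` -/

section WeakConvergence

variable {H : Type*} [NormedAddCommGroup H] [InnerProductSpace ℝ H]

lemma exists_weakly_convergent_subseq [CompleteSpace H] [TopologicalSpace.SeparableSpace H]
    {x : ℕ → H} {R : ℝ} (hx : ∀ k, ‖x k‖ ≤ R) :
    ∃ (a : H) (σ : ℕ → ℕ), StrictMono σ ∧
      ∀ z, Tendsto (fun k => inner ℝ (x (σ k)) z) atTop (𝓝 (inner ℝ a z)) := by
  obtain ⟨y, -, σ, hσ, hy⟩ := WeakDual.isSeqCompact_closedBall ℝ H 0 R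
    (x := fun k => StrongDual.toWeakDual (InnerProductSpace.toDual ℝ H (x k))) (fun k => by
      show InnerProductSpace.toDual ℝ H (x k) ∈ Metric.closedBall 0 R
      simpa using hx k)
  refine ⟨(InnerProductSpace.toDual ℝ H).symm (WeakDual.toStrongDual y), σ, hσ, fun z => ?_⟩
  rw [InnerProductSpace.toDual_symm_apply]
  exact ((WeakDual.eval_continuous z).tendsto y).comp hy

lemma norm_le_of_weakly_tendsto {g : ℕ → H} {a : H}
    (hg : Tendsto (fun k => inner ℝ (g k) a) atTop (𝓝 (inner ℝ a a)))
    {C : ℕ → ℝ} {c : ℝ} (hC : Tendsto C atTop (𝓝 c)) (hgC : ∀ k, ‖g k‖ ≤ C k) : ‖a‖ ≤ c := by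
  have h1 : inner ℝ a a ≤ c * ‖a‖ :=
    le_of_tendsto_of_tendsto' hg (hC.mul_const ‖a‖) fun k =>
      (real_inner_le_norm _ _).trans (by gcongr; exact hgC k)
  rw [real_inner_self_eq_norm_mul_norm] at h1
  rcases (norm_nonneg a).eq_or_lt with h | h
  · rw [← h]
    exact ge_of_tendsto' hC fun k => (norm_nonneg _).trans (hgC k)
  · exact le_of_mul_le_mul_right h1 h

end WeakConvergence

lemma eLpNorm_two_sq {α : Type*} [MeasurableSpace α] (μ : Measure α) (f : α → ℝ) :
    eLpNorm f 2 μ ^ 2 = ∫⁻ x, ‖f x‖ₑ ^ 2 ∂μ := by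
  have := eLpNorm_nnreal_pow_eq_lintegral (f := f) (μ := μ) (p := 2) two_ne_zero
  simpa using this

lemma memLp_two_of_lintegral_sq {α : Type*} [MeasurableSpace α] {μ : Measure α} {f : α → ℝ}
    (hf : Measurable f) (h : ∫⁻ x, ‖f x‖ₑ ^ 2 ∂μ ≠ ⊤) : MemLp f 2 μ := by
  refine ⟨hf.aestronglyMeasurable, ?_⟩
  rw [← eLpNorm_two_sq] at h
  exact lt_top_iff_ne_top.2 fun h' => h (by rw [h']; simp)

section Compactness

variable {E : Type*} [NormedAddCommGroup E] [NormedSpace ℝ E] [FiniteDimensional ℝ E]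
  [MeasureSpace E] [BorelSpace E] [(volume : Measure E).IsAddHaarMeasure]

/-- An `L²`-bounded sequence has a subsequence with a weak `L²` limit `w`. Stated here are the
consequences of weak convergence that matter later: the integrals over balls converge, and the
translation modulus is weakly lower semicontinuous. -/
lemma exists_weak_limit {K : ℝ≥0} {f : ℕ → E → ℝ} (hm : ∀ k, Measurable (f k))
    (hK : ∀ k, ∫⁻ x, ‖f k x‖ₑ ^ 2 ≤ K) :
    ∃ (w : E → ℝ) (σ : ℕ → ℕ), Measurable w ∧ StrictMono σ ∧ ∫⁻ x, ‖w x‖ₑ ^ 2 ≤ K ∧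
      (∀ x r, Tendsto (fun k => ∫ y in Metric.ball x r, f (σ k) y) atTop
        (𝓝 (∫ y in Metric.ball x r, w y))) ∧
      ∀ (h : E) (C : ℕ → ℝ≥0) (c : ℝ≥0), Tendsto C atTop (𝓝 c) →
        (∀ k, diffSq (f k) h ≤ C k) → diffSq w h ≤ c := by
  have hL : ∀ k, MemLp (f k) 2 volume := fun k =>
    memLp_two_of_lintegral_sq (hm k) ((hK k).trans_lt ENNReal.coe_lt_top).ne
  -- passing between `L²` norms and integrals of squares
  have hsq : ∀ {g : E → ℝ} (hg : MemLp g 2 volume) (c : ℝ≥0),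
      ∫⁻ x, ‖g x‖ₑ ^ 2 ≤ c ↔ ‖hg.toLp g‖ ≤ NNReal.sqrt c := fun {g} hg c => by
    rw [← eLpNorm_two_sq, ← Lp.enorm_toLp (hf := hg), ← ofReal_norm, ← ENNReal.ofReal_pow
      (norm_nonneg _), ENNReal.ofReal_le_iff_le_toReal ENNReal.coe_ne_top, Real.coe_sqrt,
      Real.le_sqrt (norm_nonneg _) c.coe_nonneg]
    simp
  have : Fact ((2 : ℝ≥0∞) ≠ ⊤) := ⟨by norm_num⟩
  obtain ⟨a, σ, hσ, ha⟩ := exists_weakly_convergent_subseq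
    (x := fun k => (hL k).toLp (f k)) (fun k => (hsq (hL k) K).1 (hK k))
  set w : E → ℝ := (Lp.aestronglyMeasurable a).mk a with hw
  have hwm : Measurable w := (Lp.aestronglyMeasurable a).stronglyMeasurable_mk.measurable
  have hwa : a =ᵐ[volume] w := (Lp.aestronglyMeasurable a).ae_eq_mk
  have hwL : MemLp w 2 volume := (memLp_congr_ae hwa).1 (Lp.memLp a)
  have hwLp : hwL.toLp w = a := by
    rw [← Lp.toLp_coeFn a (Lp.memLp a), MemLp.toLp_eq_toLp_iff]
    exact hwa.symm
  refine ⟨w, σ, hwm, hσ, ?_, fun x r => ?_, fun h C c hC hfC => ?_⟩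
  · rw [hsq hwL, hwLp]
    exact norm_le_of_weakly_tendsto (ha a) tendsto_const_nhds fun k => (hsq (hL _) K).1 (hK _)
  · have hb := ha (indicatorConstLp 2 (Metric.isOpen_ball (x := x) (ε := r)).measurableSet
      measure_ball_lt_top.ne (1 : ℝ))
    have e0 : ∀ z : Lp ℝ 2 (volume : Measure E),
        inner ℝ z (indicatorConstLp 2 (Metric.isOpen_ball (x := x) (ε := r)).measurableSet
          measure_ball_lt_top.ne (1 : ℝ)) = ∫ y in Metric.ball x r, z y := fun z => by
      rw [real_inner_comm, L2.inner_indicatorConstLp_one]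
    simp_rw [e0] at hb
    have e1 : ∀ k, ∫ y in Metric.ball x r, f (σ k) y
        = ∫ y in Metric.ball x r, (hL (σ k)).toLp (f (σ k)) y := fun k =>
      integral_congr_ae (ae_restrict_of_ae (hL (σ k)).coeFn_toLp.symm)
    have e2 : ∫ y in Metric.ball x r, w y = ∫ y in Metric.ball x r, a y :=
      integral_congr_ae (ae_restrict_of_ae hwa.symm)
    simp_rw [e1, e2]
    exact hb
  · have hmp : MeasurePreserving (fun x : E => x + h) volume volume :=
      measurePreserving_add_right volume h
    set T : Lp ℝ 2 (volume : Measure E) →L[ℝ] Lp ℝ 2 (volume : Measure E) :=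
      (Lp.compMeasurePreservingₗᵢ ℝ (fun x : E => x + h) hmp).toContinuousLinearMap -
        ContinuousLinearMap.id ℝ _ with hT
    have hTg : ∀ {g : E → ℝ} (hg : MemLp g 2 volume),
        T (hg.toLp g) = ((hg.comp_measurePreserving hmp).sub hg).toLp _ := fun hg => by
      rw [MemLp.toLp_sub (hg.comp_measurePreserving hmp) hg]
      rfl
    have hd : ∀ {g : E → ℝ} (hg : MemLp g 2 volume) (c : ℝ≥0),
        diffSq g h ≤ c ↔ ‖T (hg.toLp g)‖ ≤ NNReal.sqrt c := fun hg c => by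
      rw [hTg hg]
      exact hsq ((hg.comp_measurePreserving hmp).sub hg) c
    rw [hd hwL, hwLp]
    refine norm_le_of_weakly_tendsto (g := fun k => T ((hL (σ k)).toLp (f (σ k))))
      (C := fun k => NNReal.sqrt (C (σ k))) ?_ ?_ fun k => (hd (hL _) _).1 (hfC _)
    · have := ha (T.adjoint (T a))
      simpa only [ContinuousLinearMap.adjoint_inner_right] using this
    · exact (NNReal.continuous_coe.tendsto _).comp
        ((NNReal.continuous_sqrt.tendsto c).comp (hC.comp hσ.tendsto_atTop))

lemma sq_setLIntegral_le {B : Set E} {g : E → ℝ≥0∞} (hg : AEMeasurable g (volume.restrict B)) :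
    (∫⁻ x in B, g x) ^ 2 ≤ volume B * ∫⁻ x in B, g x ^ 2 := by
  have := ENNReal.lintegral_mul_norm_pow_le (μ := volume.restrict B) (f := fun _ => 1)
    (g := fun x => g x ^ 2) (by fun_prop) (by fun_prop) (p := 1 / 2) (q := 1 / 2)
    (by norm_num) (by norm_num) (by norm_num)
  have e : ∀ y : ℝ≥0∞, (y ^ 2) ^ (1 / 2 : ℝ) = y := fun y => by
    rw [← ENNReal.rpow_two, ← ENNReal.rpow_mul]; norm_num
  have e' : ∀ y : ℝ≥0∞, (y ^ (1 / 2 : ℝ)) ^ 2 = y := fun y => by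
    rw [← ENNReal.rpow_two, ← ENNReal.rpow_mul]; norm_num
  simp only [ENNReal.one_rpow, one_mul, e, lintegral_const,
    Measure.restrict_apply_univ] at this
  calc _ ≤ ((volume B) ^ (1 / 2 : ℝ) * (∫⁻ x in B, g x ^ 2) ^ (1 / 2 : ℝ)) ^ 2 := by gcongr
    _ = _ := by rw [mul_pow, e', e']

/-- The mean of `u` over the ball of radius `r` around `x`. -/
noncomputable def ballMean (r : ℝ) (u : E → ℝ) (x : E) : ℝ :=
  (volume.real (Metric.ball (0 : E) r))⁻¹ * ∫ h in Metric.ball (0 : E) r, u (x + h)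

lemma measurable_ballMean {u : E → ℝ} (hu : Measurable u) (r : ℝ) :
    Measurable (ballMean r u) := by
  unfold ballMean
  have : Measurable fun x => ∫ h in Metric.ball (0 : E) r, u (x + h) :=
    (StronglyMeasurable.integral_prod_right' (f := fun p : E × E => u (p.1 + p.2))
      (by fun_prop : Measurable fun p : E × E => u (p.1 + p.2)).stronglyMeasurable).measurable
  fun_prop

lemma ballMean_eq (r : ℝ) (u : E → ℝ) (x : E) :
    ballMean r u x = (volume.real (Metric.ball (0 : E) r))⁻¹ * ∫ y in Metric.ball x r, u y := by
  unfold ballMean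
  congr 1
  have hmp : MeasurePreserving (fun y : E => x + y) volume volume :=
    measurePreserving_add_left volume x
  rw [← hmp.setIntegral_preimage_emb (measurableEmbedding_addLeft x) u]
  congr 3
  ext y
  simp

lemma BesovHalfBound.integrableOn_shift {K : ℝ≥0} {u : E → ℝ} (hu : BesovHalfBound K u) (x : E)
    (r : ℝ) : IntegrableOn (fun h => u (x + h)) (Metric.ball (0 : E) r) := by
  have hL : MemLp u 2 volume := memLp_two_of_lintegral_sq hu.measurable
    (hu.lintegral_sq_le.trans_lt ENNReal.coe_lt_top).ne
  have hL' : MemLp (fun h => u (x + h)) 2 volume :=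
    hL.comp_measurePreserving (measurePreserving_add_left volume x)
  have : IsFiniteMeasure (volume.restrict (Metric.ball (0 : E) r)) :=
    ⟨by rw [Measure.restrict_apply_univ]; exact measure_ball_lt_top⟩
  exact (hL'.restrict _).integrable one_le_two

lemma BesovHalfBound.enorm_ballMean_sq_le {K : ℝ≥0} {u : E → ℝ} (hu : BesovHalfBound K u) {r : ℝ}
    (hr : 0 < r) (x : E) :
    ‖ballMean r u x‖ₑ ^ 2 ≤ (volume (Metric.ball (0 : E) r))⁻¹ * K := by
  have hm := hu.measurable
  set B := Metric.ball (0 : E) r with hB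
  have hB0 : volume B ≠ 0 := (Metric.measure_ball_pos _ _ hr).ne'
  have hBt : volume B ≠ ⊤ := measure_ball_lt_top.ne
  have hBr : volume.real B ≠ 0 := (ENNReal.toReal_pos hB0 hBt).ne'
  unfold ballMean
  rw [← hB, enorm_mul, enorm_inv hBr, mul_pow,
    Real.enorm_of_nonneg measureReal_nonneg, ofReal_measureReal hBt]
  calc _ ≤ (volume B)⁻¹ ^ 2 * (volume B * K) := by
        gcongr
        calc _ ≤ (∫⁻ h in B, ‖u (x + h)‖ₑ) ^ 2 := by gcongr; exact enorm_integral_le_lintegral_enorm _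
          _ ≤ volume B * ∫⁻ h in B, ‖u (x + h)‖ₑ ^ 2 := sq_setLIntegral_le (by fun_prop)
          _ ≤ volume B * ∫⁻ h, ‖u (x + h)‖ₑ ^ 2 := by gcongr; exact Measure.restrict_le_self
          _ = volume B * ∫⁻ h, ‖u h‖ₑ ^ 2 := by
            rw [lintegral_add_left_eq_self (fun h => ‖u h‖ₑ ^ 2) x]
          _ ≤ _ := by gcongr; exact hu.lintegral_sq_le
    _ = (volume B)⁻¹ * ((volume B)⁻¹ * volume B) * K := by ring
    _ = _ := by rw [ENNReal.inv_mul_cancel hB0 hBt, mul_one]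

lemma BesovHalfBound.lintegral_sub_ballMean_sq_le {K : ℝ≥0} {u : E → ℝ} (hu : BesovHalfBound K u)
    {r : ℝ} (hr : 0 < r) :
    ∫⁻ x, ‖u x - ballMean r u x‖ₑ ^ 2 ≤ K * ENNReal.ofReal r := by
  have hm := hu.measurable
  set B := Metric.ball (0 : E) r with hB
  have hB0 : volume B ≠ 0 := (Metric.measure_ball_pos _ _ hr).ne'
  have hBt : volume B ≠ ⊤ := measure_ball_lt_top.ne
  have hBr : volume.real B ≠ 0 := (ENNReal.toReal_pos hB0 hBt).ne'
  have hpt : ∀ x, ‖u x - ballMean r u x‖ₑ ^ 2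
      ≤ (volume B)⁻¹ * ∫⁻ h in B, ‖u (x + h) - u x‖ₑ ^ 2 := by
    intro x
    have hi : IntegrableOn (fun _ : E => u x) B := integrableOn_const hBt
    have e : u x - ballMean r u x = (volume.real B)⁻¹ * ∫ h in B, (u x - u (x + h)) := by
      rw [integral_sub hi (hu.integrableOn_shift x r), setIntegral_const, smul_eq_mul, mul_sub,
        inv_mul_cancel_left₀ hBr]
      rfl
    rw [e, enorm_mul, enorm_inv hBr, mul_pow, Real.enorm_of_nonneg measureReal_nonneg,
      ofReal_measureReal hBt]
    calc _ ≤ (volume B)⁻¹ ^ 2 * (volume B * ∫⁻ h in B, ‖u (x + h) - u x‖ₑ ^ 2) := by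
          gcongr
          calc _ ≤ (∫⁻ h in B, ‖u x - u (x + h)‖ₑ) ^ 2 := by
                gcongr; exact enorm_integral_le_lintegral_enorm _
            _ ≤ volume B * ∫⁻ h in B, ‖u x - u (x + h)‖ₑ ^ 2 := sq_setLIntegral_le (by fun_prop)
            _ = _ := by simp_rw [← enorm_neg (u x - u _), neg_sub]
      _ = (volume B)⁻¹ * ((volume B)⁻¹ * volume B) * ∫⁻ h in B, ‖u (x + h) - u x‖ₑ ^ 2 := by
          ring
      _ = _ := by rw [ENNReal.inv_mul_cancel hB0 hBt, mul_one]
  calc _ ≤ ∫⁻ x, (volume B)⁻¹ * ∫⁻ h in B, ‖u (x + h) - u x‖ₑ ^ 2 := lintegral_mono hpt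
    _ = (volume B)⁻¹ * ∫⁻ h in B, diffSq u h := by
        rw [lintegral_const_mul' _ _ (ENNReal.inv_ne_top.2 hB0), lintegral_lintegral_swap
          (by fun_prop)]
        rfl
    _ ≤ (volume B)⁻¹ * ∫⁻ _ in B, K * ENNReal.ofReal r := by
        refine mul_le_mul' le_rfl ?_
        refine setLIntegral_mono' Metric.isOpen_ball.measurableSet fun h hh => ?_
        refine (hu.diffSq_le h).trans ?_
        gcongr
        exact (mem_ball_zero_iff.1 hh).le
    _ = ((volume B)⁻¹ * volume B) * (K * ENNReal.ofReal r) := by rw [setLIntegral_const]; ring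
    _ = _ := by rw [ENNReal.inv_mul_cancel hB0 hBt, one_mul]

/-- A sequence that is bounded in `B^{1/2}_{2,∞}` and whose integrals over balls tend to `0` tends
to `0` in `L²` on sets of finite measure: the means over balls of a fixed radius `r` tend to `0`
boundedly, and they differ from the functions by `O(√r)` in `L²`, uniformly in the sequence. -/
lemma tendsto_setLIntegral_sq {K : ℝ≥0} {f : ℕ → E → ℝ} (hf : ∀ k, BesovHalfBound K (f k))
    (hball : ∀ x r, Tendsto (fun k => ∫ y in Metric.ball x r, f k y) atTop (𝓝 0))
    {S : Set E} (hS : volume S ≠ ⊤) :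
    Tendsto (fun k => ∫⁻ x in S, ‖f k x‖ₑ ^ 2) atTop (𝓝 0) := by
  have hlim : ∀ r : ℝ, 0 < r →
      Tendsto (fun k => ∫⁻ x in S, ‖ballMean r (f k) x‖ₑ ^ 2) atTop (𝓝 0) := by
    intro r hr
    have hfin : ∫⁻ _ in S, (volume (Metric.ball (0 : E) r))⁻¹ * (K : ℝ≥0∞) ≠ ⊤ := by
      rw [setLIntegral_const]
      exact ENNReal.mul_ne_top (ENNReal.mul_ne_top
        (ENNReal.inv_ne_top.2 (Metric.measure_ball_pos _ _ hr).ne') ENNReal.coe_ne_top) hS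
    have := tendsto_lintegral_of_dominated_convergence (μ := volume.restrict S)
      (F := fun k x => ‖ballMean r (f k) x‖ₑ ^ 2) (f := fun _ => 0) _
      (fun k => ((measurable_ballMean (hf k).measurable r).enorm.pow_const 2))
      (fun k => ae_of_all _ fun x => (hf k).enorm_ballMean_sq_le hr x) hfin
      (ae_of_all _ fun x => by
        have h1 : Tendsto (fun k => ballMean r (f k) x) atTop (𝓝 0) := by
          simp_rw [ballMean_eq]
          simpa using (hball x r).const_mul (volume.real (Metric.ball (0 : E) r))⁻¹
        have h2 := (ENNReal.continuous_pow 2).tendsto _ |>.comp (h1.enorm)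
        simpa [Function.comp_def] using h2)
    simpa using this
  rw [ENNReal.tendsto_nhds_zero]
  intro ε hε
  obtain ⟨r, hr, hrε⟩ : ∃ r : ℝ, 0 < r ∧ 2 * (K * ENNReal.ofReal r) ≤ ε / 2 := by
    have h1 : Tendsto (fun r : ℝ => 2 * (K * ENNReal.ofReal r)) (𝓝[>] 0) (𝓝 0) := by
      have h2 : Tendsto (fun r : ℝ => 2 * ((K : ℝ≥0∞) * ENNReal.ofReal r)) (𝓝 0)
          (𝓝 (2 * (K * ENNReal.ofReal 0))) :=
        ENNReal.Tendsto.const_mul (ENNReal.Tendsto.const_mul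
          (ENNReal.continuous_ofReal.tendsto 0) (Or.inr ENNReal.coe_ne_top)) (Or.inr (by norm_num))
      simp only [ENNReal.ofReal_zero, mul_zero] at h2
      exact h2.mono_left nhdsWithin_le_nhds
    have h3 := (ENNReal.tendsto_nhds_zero.1 h1 (ε / 2) (ENNReal.half_pos hε.ne'))
    obtain ⟨r, h4, h5⟩ := (h3.and self_mem_nhdsWithin).exists
    exact ⟨r, h5, h4⟩
  have h2 : Tendsto (fun k => 2 * ∫⁻ x in S, ‖ballMean r (f k) x‖ₑ ^ 2) atTop (𝓝 0) := by
    have := ENNReal.Tendsto.const_mul (hlim r hr) (a := 2) (Or.inr (by norm_num))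
    rwa [mul_zero] at this
  filter_upwards [ENNReal.tendsto_nhds_zero.1 h2 (ε / 2) (ENNReal.half_pos hε.ne')] with k hk
  have hm := (hf k).measurable
  have hm' := measurable_ballMean hm r
  calc ∫⁻ x in S, ‖f k x‖ₑ ^ 2
      ≤ ∫⁻ x in S, (2 * ‖f k x - ballMean r (f k) x‖ₑ ^ 2 + 2 * ‖ballMean r (f k) x‖ₑ ^ 2) := by
        refine lintegral_mono fun x => ?_
        have := enorm_add_sq_le (f k x - ballMean r (f k) x) (ballMean r (f k) x)
        rwa [sub_add_cancel] at this
    _ = 2 * (∫⁻ x in S, ‖f k x - ballMean r (f k) x‖ₑ ^ 2)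
          + 2 * ∫⁻ x in S, ‖ballMean r (f k) x‖ₑ ^ 2 := by
        rw [lintegral_add_left (by fun_prop), lintegral_const_mul _ (by fun_prop),
          lintegral_const_mul _ (by fun_prop)]
    _ ≤ 2 * (K * ENNReal.ofReal r) + ε / 2 := by
        gcongr
        exact (setLIntegral_le_lintegral _ _).trans ((hf k).lintegral_sub_ballMean_sq_le hr)
    _ ≤ ε / 2 + ε / 2 := by gcongr
    _ = ε := ENNReal.add_halves _

end Compactness

/-! ### Weak derivatives and almost everywhere convergence -/

section WeakDerivative

variable {E : Type*} [NormedAddCommGroup E] [NormedSpace ℝ E] [FiniteDimensional ℝ E]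
  [MeasureSpace E] [BorelSpace E] [(volume : Measure E).IsAddHaarMeasure]

/-- Only the values of `w` on a compact neighbourhood of the support of `φ` enter, so `w` may be
replaced by an integrable function. -/
lemma tendsto_integral_differenceQuotient {w φ : E → ℝ} (hw : LocallyIntegrable w)
    (hφ : ContDiff ℝ ∞ φ) (hc : HasCompactSupport φ) (e : E) :
    Tendsto (fun t : ℝ => ∫ x, w x * (t⁻¹ * (φ (x + t • e) - φ x))) (𝓝[>] 0)
      (𝓝 (∫ x, w x * fderiv ℝ φ x e)) := by
  obtain ⟨C, hC⟩ := hφ.lipschitzWith_of_hasCompactSupport hc (by simp)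
  set Q := Metric.cthickening ‖e‖ (tsupport φ) with hQ
  have hQc : IsCompact Q := IsCompact.cthickening hc
  have hsub : tsupport φ ⊆ Q := Metric.self_subset_cthickening _
  have hwi : Integrable (Q.indicator w) := by
    rw [integrable_indicator_iff hQc.measurableSet]
    exact hw.integrableOn_isCompact hQc
  have h := hC.integral_inv_smul_sub_mul_tendsto_integral_lineDeriv_mul hwi e
  have e1 : ∫ x, lineDeriv ℝ φ x e * Q.indicator w x = ∫ x, w x * fderiv ℝ φ x e := by
    refine integral_congr_ae (ae_of_all _ fun x => ?_)
    have hd : lineDeriv ℝ φ x e = fderiv ℝ φ x e :=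
      (hφ.differentiable (by simp) x).lineDeriv_eq_fderiv
    simp only [hd]
    by_cases hx : x ∈ Q
    · rw [Set.indicator_of_mem hx, mul_comm]
    · rw [fderiv_of_notMem_tsupport (𝕜 := ℝ) (fun h' => hx (hsub h'))]
      simp
  rw [e1] at h
  refine h.congr' ?_
  have hlt : ∀ᶠ t : ℝ in 𝓝[>] 0, t < 1 := mem_nhdsWithin_of_mem_nhds (gt_mem_nhds one_pos)
  filter_upwards [hlt, self_mem_nhdsWithin] with t ht1 ht0
  refine integral_congr_ae (ae_of_all _ fun x => ?_)
  by_cases hx : x ∈ Q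
  · simp only [Set.indicator_of_mem hx, smul_eq_mul]
    ring
  · have h1 : φ x = 0 := image_eq_zero_of_notMem_tsupport fun h' => hx (hsub h')
    have h2 : φ (x + t • e) = 0 := by
      refine image_eq_zero_of_notMem_tsupport fun h' => hx ?_
      refine Metric.mem_cthickening_of_dist_le x _ _ _ h' ?_
      rw [dist_self_add_right, norm_smul, Real.norm_of_nonneg (le_of_lt ht0)]
      exact mul_le_of_le_one_left (norm_nonneg _) ht1.le
    simp [h1, h2]

/-- An `L²` function with `‖w(· + h) - w‖² ≤ M ‖h‖²` has weak directional derivatives in `L²`: they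
are weak limits of difference quotients. -/
lemma exists_weak_directional_deriv {w : E → ℝ} (hm : Measurable w) (hw : MemLp w 2 volume)
    {M : ℝ≥0} (hM : ∀ h, diffSq w h ≤ ENNReal.ofReal (‖h‖ ^ 2) * M) (e : E) :
    ∃ g : E → ℝ, MemLp g 2 volume ∧ ∀ φ : E → ℝ, ContDiff ℝ ∞ φ → HasCompactSupport φ →
      ∫ x, w x * fderiv ℝ φ x e = -∫ x, g x * φ x := by
  set t : ℕ → ℝ := fun k => 1 / ((k : ℝ) + 1) with ht
  have ht0 : ∀ k, 0 < t k := fun k => by positivity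
  have htl : Tendsto t atTop (𝓝[>] 0) := tendsto_nhdsWithin_iff.2
    ⟨tendsto_one_div_add_atTop_nhds_zero_nat, Eventually.of_forall fun k => ht0 k⟩
  set q : ℕ → E → ℝ := fun k x => (t k)⁻¹ * (w (x + -(t k • e)) - w x) with hq
  have hqm : ∀ k, Measurable (q k) := fun k => by fun_prop
  have hqb : ∀ k, ∫⁻ x, ‖q k x‖ₑ ^ 2 ≤ ENNReal.ofReal (‖e‖ ^ 2) * M := by
    intro k
    have e1 : ∫⁻ x, ‖q k x‖ₑ ^ 2 = ENNReal.ofReal ((t k)⁻¹ ^ 2) * diffSq w (-(t k • e)) := by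
      unfold diffSq
      rw [← lintegral_const_mul _ (by fun_prop)]
      refine lintegral_congr fun x => ?_
      rw [hq, enorm_mul, mul_pow, Real.enorm_of_nonneg (inv_nonneg.2 (ht0 k).le),
        ENNReal.ofReal_pow (inv_nonneg.2 (ht0 k).le)]
    rw [e1]
    calc _ ≤ ENNReal.ofReal ((t k)⁻¹ ^ 2) * (ENNReal.ofReal (‖-(t k • e)‖ ^ 2) * M) := by
          gcongr; exact hM _
      _ = _ := by
          rw [← mul_assoc, ← ENNReal.ofReal_mul (by positivity), norm_neg, norm_smul,
            Real.norm_of_nonneg (ht0 k).le, mul_pow, ← mul_assoc, ← mul_pow,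
            inv_mul_cancel₀ (ht0 k).ne', one_pow, one_mul]
  have hcf : ENNReal.ofReal (‖e‖ ^ 2) * (M : ℝ≥0∞) ≠ ⊤ :=
    ENNReal.mul_ne_top ENNReal.ofReal_ne_top ENNReal.coe_ne_top
  have hqL : ∀ k, MemLp (q k) 2 volume := fun k =>
    memLp_two_of_lintegral_sq (hqm k) ((hqb k).trans_lt hcf.lt_top).ne
  have : Fact ((2 : ℝ≥0∞) ≠ ⊤) := ⟨by norm_num⟩
  obtain ⟨a, σ, hσ, ha⟩ := exists_weakly_convergent_subseq (x := fun k => (hqL k).toLp (q k))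
    (R := √(ENNReal.ofReal (‖e‖ ^ 2) * M).toReal) (fun k => by
      have h1 := hqb k
      rw [← eLpNorm_two_sq, ← Lp.enorm_toLp (hf := hqL k), ← ofReal_norm, ← ENNReal.ofReal_pow
        (norm_nonneg _), ENNReal.ofReal_le_iff_le_toReal hcf] at h1
      exact Real.le_sqrt_of_sq_le h1)
  refine ⟨fun x => -a x, (Lp.memLp a).neg, fun φ hφ hc => ?_⟩
  have hφL : MemLp φ 2 volume := hφ.continuous.memLp_of_hasCompactSupport hc
  have hin : ∀ {f : E → ℝ} (hf : MemLp f 2 volume),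
      inner ℝ (hf.toLp f) (hφL.toLp φ) = ∫ x, f x * φ x := fun {f} hf => by
    rw [L2.inner_def]
    refine integral_congr_ae ?_
    filter_upwards [hf.coeFn_toLp, hφL.coeFn_toLp] with x h1 h2
    rw [h1, h2]
    simp [mul_comm]
  have hlim := ha (hφL.toLp φ)
  rw [show inner ℝ a (hφL.toLp φ) = ∫ x, a x * φ x by
    rw [← hin (Lp.memLp a), Lp.toLp_coeFn]] at hlim
  simp_rw [hin] at hlim
  -- discrete integration by parts
  have hparts : ∀ k, ∫ x, q k x * φ x
      = ∫ x, w x * ((t k)⁻¹ * (φ (x + t k • e) - φ x)) := by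
    intro k
    have hmp : MeasurePreserving (fun x : E => x + -(t k • e)) volume volume :=
      measurePreserving_add_right volume _
    have hmp' : MeasurePreserving (fun x : E => x + t k • e) volume volume :=
      measurePreserving_add_right volume _
    have i0 : Integrable (fun x => w x * φ x) := hw.integrable_mul hφL
    have i1 : Integrable (fun x => w (x + -(t k • e)) * φ x) :=
      (hw.comp_measurePreserving hmp).integrable_mul hφL
    have i2 : Integrable (fun x => w x * φ (x + t k • e)) :=
      hw.integrable_mul (hφL.comp_measurePreserving hmp')
    have hshift : ∫ x, w (x + -(t k • e)) * φ x = ∫ x, w x * φ (x + t k • e) := by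
      rw [← integral_add_right_eq_self (fun x => w (x + -(t k • e)) * φ x) (t k • e)]
      simp
    calc ∫ x, q k x * φ x
        = ∫ x, (t k)⁻¹ * (w (x + -(t k • e)) * φ x - w x * φ x) := by
          congr 1; ext x; simp only [hq]; ring
      _ = ∫ x, (t k)⁻¹ * (w x * φ (x + t k • e) - w x * φ x) := by
          rw [integral_const_mul, integral_const_mul, integral_sub i1 i0, integral_sub i2 i0,
            hshift]
      _ = _ := by congr 1; ext x; ring
  simp_rw [hparts] at hlim
  have hlim' := (tendsto_integral_differenceQuotient (hw.locallyIntegrable one_le_two) hφ hc e).comp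
    (htl.comp hσ.tendsto_atTop)
  rw [tendsto_nhds_unique hlim' hlim, ← integral_neg]
  simp

end WeakDerivative

section Subsequence

/-- A sequence tending to `0` in `L²` on every ball has an almost everywhere convergent
subsequence: the `n`-th term is chosen with `∫ |f|² ≤ 2 ^ (-n)` on the ball of radius `n`. -/
lemma exists_subseq_ae_tendsto {E : Type*} [NormedAddCommGroup E] [MeasureSpace E]
    [OpensMeasurableSpace E] {f : ℕ → E → ℝ} (hm : ∀ k, Measurable (f k))
    (hf : ∀ n : ℕ, Tendsto (fun k => ∫⁻ x in Metric.closedBall (0 : E) n, ‖f k x‖ₑ ^ 2) atTop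
      (𝓝 0)) :
    ∃ σ : ℕ → ℕ, StrictMono σ ∧ ∀ᵐ x, Tendsto (fun k => f (σ k) x) atTop (𝓝 0) := by
  obtain ⟨σ, hσ, hb⟩ := extraction_forall_of_eventually (P := fun n k =>
      ∫⁻ x in Metric.closedBall (0 : E) n, ‖f k x‖ₑ ^ 2 ≤ 2⁻¹ ^ n) fun n =>
    ENNReal.tendsto_nhds_zero.1 (hf n) _ (ENNReal.pow_pos (by norm_num) n)
  refine ⟨σ, hσ, ?_⟩
  have hball : ∀ m : ℕ, ∀ᵐ x, x ∈ Metric.closedBall (0 : E) m →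
      Tendsto (fun k => f (σ k) x) atTop (𝓝 0) := by
    intro m
    set S := Metric.closedBall (0 : E) m with hS
    have hfin : ∫⁻ x in S, ∑' n, ‖f (σ (n + m)) x‖ₑ ^ 2 ≠ ⊤ := by
      rw [lintegral_tsum fun n => ((hm _).enorm.pow_const 2).aemeasurable]
      refine ne_top_of_le_ne_top (b := ∑' n : ℕ, (2⁻¹ : ℝ≥0∞) ^ n) ?_
        (ENNReal.tsum_le_tsum fun n => ?_)
      · rw [ENNReal.tsum_geometric]
        simp
      · calc _ ≤ ∫⁻ x in Metric.closedBall (0 : E) ((n + m : ℕ) : ℝ), ‖f (σ (n + m)) x‖ₑ ^ 2 :=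
              lintegral_mono_set (Metric.closedBall_subset_closedBall (by simp))
          _ ≤ 2⁻¹ ^ (n + m) := hb _
          _ ≤ 2⁻¹ ^ n := pow_le_pow_right_of_le_one' (by simp) (by omega)
    have hae := ae_lt_top (Measurable.tsum fun n => (hm (σ (n + m))).enorm.pow_const 2) hfin
    have hae' := (ae_restrict_iff' Metric.isClosed_closedBall.measurableSet).1 hae
    filter_upwards [hae'] with x hx hxS
    have h1 := ENNReal.tendsto_atTop_zero_of_tsum_ne_top (hx hxS).ne
    rw [tendsto_add_atTop_iff_nat (f := fun n => ‖f (σ n) x‖ₑ ^ 2) m] at h1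
    have h2 := h1.ennrpow_const (1 / 2)
    rw [ENNReal.zero_rpow_of_pos (by norm_num)] at h2
    rw [tendsto_zero_iff_norm_tendsto_zero]
    have h3 := (ENNReal.tendsto_toReal ENNReal.zero_ne_top).comp h2
    refine h3.congr fun k => ?_
    simp only [Function.comp]
    rw [← ENNReal.rpow_two, ← ENNReal.rpow_mul]
    norm_num
  filter_upwards [ae_all_iff.2 hball] with x hx
  obtain ⟨m, hmx⟩ := exists_nat_ge ‖x‖
  exact hx m (mem_closedBall_zero_iff.2 hmx)

end Subsequence

/-! ### Assembling the bounds -/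

lemma gagliardoSq_congr_ae {N : ℕ} (s : ℝ) {u w : EuclideanSpace ℝ (Fin N) → ℝ}
    (h : u =ᵐ[volume] w) : gagliardoSq s u = gagliardoSq s w := by
  unfold gagliardoSq
  rw [Measure.volume_eq_prod]
  have h1 := Measure.QuasiMeasurePreserving.ae_eq_comp
    (Measure.quasiMeasurePreserving_fst (μ := (volume : Measure (EuclideanSpace ℝ (Fin N))))
      (ν := (volume : Measure (EuclideanSpace ℝ (Fin N))))) h
  have h2 := Measure.QuasiMeasurePreserving.ae_eq_comp
    (Measure.quasiMeasurePreserving_snd (μ := (volume : Measure (EuclideanSpace ℝ (Fin N))))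
      (ν := (volume : Measure (EuclideanSpace ℝ (Fin N))))) h
  refine lintegral_congr_ae ?_
  filter_upwards [h1, h2] with p hp1 hp2
  simp only [Function.comp] at hp1 hp2
  rw [hp1, hp2]

/-- The norm `‖·‖_s` controls the `L²` norm and, since `C(N, s) ≥ c (1 - s)`, the quantity
`(1 - s)` times the squared Gagliardo seminorm. -/
lemma bounds_of_hsNorm_le {N : ℕ} [NeZero N] {V : EuclideanSpace ℝ (Fin N) → ℝ}
    (hV : MemLp V ⊤ volume) {V₀ : ℝ} (hV₀ : 0 < V₀) (hVV : ∀ᵐ x, V₀ ≤ V x)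
    {c s B : ℝ} (hc : 0 < c) (hs : s < 1) (hcs : c * (1 - s) ≤ fracConst N s)
    {u : EuclideanSpace ℝ (Fin N) → ℝ} (hu : MemHs s u) (hB : hsNorm V s u ≤ B) :
    ∫⁻ x, ‖u x‖ₑ ^ 2 ≤ ENNReal.ofReal (B ^ 2 / V₀) ∧
      ENNReal.ofReal (1 - s) * gagliardoSq s u ≤ ENNReal.ofReal (2 * B ^ 2 / c) := by
  have hsum : fracLaplacianNormSq s u + ∫ x, V x * u x ^ 2 ≤ B ^ 2 := (Real.sqrt_le_iff.1 hB).2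
  have hi : Integrable fun x => u x ^ 2 := hu.1.integrable_sq
  have hiV : Integrable fun x => V x * u x ^ 2 := hi.smul_of_top_right hV
  have h1s : 0 < 1 - s := by linarith
  have hC : 0 < fracConst N s := (mul_pos hc h1s).trans_le hcs
  have hG0 : 0 ≤ (gagliardoSq s u).toReal := ENNReal.toReal_nonneg
  have hF : c * (1 - s) / 2 * (gagliardoSq s u).toReal ≤ fracLaplacianNormSq s u := by
    unfold fracLaplacianNormSq
    gcongr
  have hF0 : 0 ≤ fracLaplacianNormSq s u := le_trans (by positivity) hF
  have hVI : V₀ * ∫ x, u x ^ 2 ≤ ∫ x, V x * u x ^ 2 := by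
    rw [← integral_const_mul]
    refine integral_mono_ae (hi.const_mul V₀) hiV ?_
    filter_upwards [hVV] with x hx
    gcongr
  have hI0 : 0 ≤ ∫ x, u x ^ 2 := integral_nonneg fun x => sq_nonneg _
  have hVI0 : 0 ≤ V₀ * ∫ x, u x ^ 2 := by positivity
  constructor
  · have e : ∫⁻ x, ‖u x‖ₑ ^ 2 = ENNReal.ofReal (∫ x, u x ^ 2) := by
      rw [ofReal_integral_eq_lintegral_ofReal hi (ae_of_all _ fun x => sq_nonneg _)]
      refine lintegral_congr fun x => ?_
      rw [Real.enorm_eq_ofReal_abs, ← ENNReal.ofReal_pow (abs_nonneg _), sq_abs]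
    rw [e]
    refine ENNReal.ofReal_le_ofReal ?_
    rw [le_div_iff₀ hV₀]
    linarith
  · rw [← ENNReal.ofReal_toReal hu.2.ne, ← ENNReal.ofReal_mul h1s.le]
    refine ENNReal.ofReal_le_ofReal ?_
    rw [le_div_iff₀ hc]
    linarith

/-- For `s ≥ 1/2`, an `L²` modulus of continuity `K ‖h‖ ^ (2 s)` gives a bound in
`B^{1/2}_{2,∞}`: large shifts are handled by the `L²` norm. -/
lemma besovHalfBound_of_diffSq_le {N : ℕ} {u : EuclideanSpace ℝ (Fin N) → ℝ} (hm : Measurable u)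
    {s : ℝ} (hs : 1 / 2 ≤ s) {K₀ K₁ : ℝ≥0} (h0 : ∫⁻ x, ‖u x‖ₑ ^ 2 ≤ K₀)
    (h1 : ∀ h, diffSq u h ≤ ENNReal.ofReal (‖h‖ ^ (2 * s)) * K₁) :
    BesovHalfBound (4 * K₀ + K₁) u where
  measurable := hm
  lintegral_sq_le := h0.trans (by
    norm_cast
    calc K₀ ≤ 4 * K₀ := le_mul_of_one_le_left (zero_le) (by norm_num)
      _ ≤ 4 * K₀ + K₁ := le_self_add)
  diffSq_le h := by
    rcases le_or_gt ‖h‖ 1 with hh | hh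
    · calc _ ≤ ENNReal.ofReal (‖h‖ ^ (2 * s)) * K₁ := h1 h
        _ ≤ ENNReal.ofReal ‖h‖ * K₁ := by
            gcongr
            calc ‖h‖ ^ (2 * s) ≤ ‖h‖ ^ (1 : ℝ) :=
                  Real.rpow_le_rpow_of_exponent_ge' (norm_nonneg _) hh zero_le_one (by linarith)
              _ = ‖h‖ := Real.rpow_one _
        _ ≤ _ := by
            rw [mul_comm]
            gcongr
            exact le_add_self
    · calc _ ≤ 4 * ∫⁻ x, ‖u x‖ₑ ^ 2 := diffSq_le_four_mul hm h
        _ ≤ 4 * K₀ := by gcongr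
        _ ≤ ((4 * K₀ + K₁ : ℝ≥0) : ℝ≥0∞) := by
            push_cast; exact le_self_add
        _ ≤ ((4 * K₀ + K₁ : ℝ≥0) : ℝ≥0∞) * ENNReal.ofReal ‖h‖ := by
            refine le_mul_of_one_le_right (zero_le) ?_
            rw [ENNReal.one_le_ofReal]
            exact hh.le

/-- The Bourgain–Brezis–Mironescu compactness principle, in terms of uniform bounds on
`‖u_n‖²` and on `(1 - s_n) [u_n]²_{s_n}`. -/
lemma exists_subseq_of_bounds {N : ℕ} (hN : 2 ≤ N) {s : ℕ → ℝ} (hs : ∀ n, 1 / 2 < s n ∧ s n < 1)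
    (hs_lim : Tendsto s atTop (𝓝 1)) {u : ℕ → EuclideanSpace ℝ (Fin N) → ℝ}
    (hm : ∀ n, Measurable (u n)) {K₀ K₁ : ℝ≥0} (h0 : ∀ n, ∫⁻ x, ‖u n x‖ₑ ^ 2 ≤ K₀)
    (h1 : ∀ n, ENNReal.ofReal (1 - s n) * gagliardoSq (s n) (u n) ≤ K₁) :
    ∃ (w : EuclideanSpace ℝ (Fin N) → ℝ) (σ : ℕ → ℕ), MemH1 w ∧ StrictMono σ ∧
      (∀ q : ℝ, 2 ≤ q → q < 2 * N / (N - 1) → TendstoLqLoc q (fun k => u (σ k)) w) ∧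
      ∀ᵐ x, Tendsto (fun k => u (σ k) x) atTop (𝓝 (w x)) := by
  have hB0 : volume (Metric.ball (0 : EuclideanSpace ℝ (Fin N)) 1) ≠ 0 :=
    (Metric.measure_ball_pos _ _ one_pos).ne'
  obtain ⟨K₂, hK₂⟩ : ∃ K₂ : ℝ≥0, ∀ n h,
      diffSq (u n) h ≤ ENNReal.ofReal (‖h‖ ^ (2 * s n)) * K₂ := by
    have hfin : ENNReal.ofReal (8 * 8 ^ N) *
        (volume (Metric.ball (0 : EuclideanSpace ℝ (Fin N)) 1))⁻¹ * (K₁ : ℝ≥0∞) ≠ ⊤ :=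
      ENNReal.mul_ne_top (ENNReal.mul_ne_top ENNReal.ofReal_ne_top (ENNReal.inv_ne_top.2 hB0))
        ENNReal.coe_ne_top
    refine ⟨(ENNReal.ofReal (8 * 8 ^ N) *
      (volume (Metric.ball (0 : EuclideanSpace ℝ (Fin N)) 1))⁻¹ * K₁).toNNReal, fun n h => ?_⟩
    rw [ENNReal.coe_toNNReal hfin]
    refine (diffSq_le_rpow_mul_gagliardoSq (by linarith [(hs n).1]) (hs n).2 (hm n) h).trans ?_
    gcongr
    exact h1 n
  set K := 4 * K₀ + K₂ with hK
  have hbes : ∀ n, BesovHalfBound K (u n) := fun n =>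
    besovHalfBound_of_diffSq_le (hm n) (hs n).1.le (h0 n) (hK₂ n)
  obtain ⟨w, σ, hwm, hσ, hwK, hball, hlsc⟩ :=
    exists_weak_limit hm fun n => (hbes n).lintegral_sq_le
  have hwbes : BesovHalfBound K w := by
    refine ⟨hwm, hwK, fun h => ?_⟩
    have e : (K : ℝ≥0∞) * ENNReal.ofReal ‖h‖ = ((K * ‖h‖.toNNReal : ℝ≥0) : ℝ≥0∞) := by
      rw [ENNReal.coe_mul]; rfl
    rw [e]
    exact hlsc h _ _ tendsto_const_nhds fun k => by rw [← e]; exact (hbes k).diffSq_le h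
  have hwL : MemLp w 2 volume :=
    memLp_two_of_lintegral_sq hwm (hwK.trans_lt ENNReal.coe_lt_top).ne
  have hw2 : ∀ h, diffSq w h ≤ ENNReal.ofReal (‖h‖ ^ 2) * K₂ := by
    intro h
    have hlim : Tendsto (fun n => (‖h‖ ^ (2 * s n)).toNNReal * K₂) atTop
        (𝓝 ((‖h‖ ^ 2).toNNReal * K₂)) := by
      have h2 : Tendsto (fun n => 2 * s n) atTop (𝓝 2) := by
        simpa using hs_lim.const_mul 2
      have h3 : Tendsto (fun n => ‖h‖ ^ (2 * s n)) atTop (𝓝 (‖h‖ ^ (2 : ℝ))) :=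
        tendsto_const_nhds.rpow h2 (Or.inr two_pos)
      rw [Real.rpow_two] at h3
      exact ((continuous_real_toNNReal.tendsto _).comp h3).mul_const K₂
    have := hlsc h _ _ hlim fun k => by
      rw [ENNReal.coe_mul]
      exact hK₂ k h
    rwa [ENNReal.coe_mul] at this
  have hH1 : MemH1 w := ⟨hwL, fun i => exists_weak_directional_deriv hwm hwL hw2 _⟩
  -- the differences `u (σ k) - w` tend to `0` in `L²` on sets of finite measure
  set f : ℕ → EuclideanSpace ℝ (Fin N) → ℝ := fun k x => u (σ k) x - w x with hf
  have hfbes : ∀ k, BesovHalfBound (4 * K) (f k) := fun k => (hbes (σ k)).sub hwbes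
  have hfball : ∀ x r, Tendsto (fun k => ∫ y in Metric.ball x r, f k y) atTop (𝓝 0) := by
    intro x r
    have hi : ∀ {g : EuclideanSpace ℝ (Fin N) → ℝ}, MemLp g 2 volume →
        IntegrableOn g (Metric.ball x r) := fun hg =>
      ((hg.locallyIntegrable one_le_two).integrableOn_isCompact
        (isCompact_closedBall x r)).mono_set Metric.ball_subset_closedBall
    have hL : ∀ k, MemLp (u k) 2 volume := fun k =>
      memLp_two_of_lintegral_sq (hm k) ((h0 k).trans_lt ENNReal.coe_lt_top).ne
    have e : ∀ k, ∫ y in Metric.ball x r, f k y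
        = (∫ y in Metric.ball x r, u (σ k) y) - ∫ y in Metric.ball x r, w y := fun k =>
      integral_sub (hi (hL _)) (hi hwL)
    simp_rw [e]
    simpa using (hball x r).sub_const (∫ y in Metric.ball x r, w y)
  have hf2 : ∀ {S : Set (EuclideanSpace ℝ (Fin N))}, volume S ≠ ⊤ →
      Tendsto (fun k => ∫⁻ x in S, ‖f k x‖ₑ ^ 2) atTop (𝓝 0) := fun hS =>
    tendsto_setLIntegral_sq hfbes hfball hS
  obtain ⟨τ, hτ, hae⟩ := exists_subseq_ae_tendsto (fun k => (hfbes k).measurable)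
    fun n => hf2 (isCompact_closedBall 0 (n : ℝ)).measure_ne_top
  refine ⟨w, fun k => σ (τ k), hH1, hσ.comp hτ, fun q hq2 hqN S hS => ?_, ?_⟩
  · have hq0 : 0 < q := by linarith
    have hd : 2 ≤ Module.finrank ℝ (EuclideanSpace ℝ (Fin N)) := by
      rwa [finrank_euclideanSpace_fin]
    have hqN' : q < 2 * Module.finrank ℝ (EuclideanSpace ℝ (Fin N)) /
        (Module.finrank ℝ (EuclideanSpace ℝ (Fin N)) - 1) := by
      rwa [finrank_euclideanSpace_fin]
    have hSt := hS.measure_ne_top (μ := (volume : Measure (EuclideanSpace ℝ (Fin N))))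
    have hnorm : ∀ g : EuclideanSpace ℝ (Fin N) → ℝ,
        eLpNorm g (ENNReal.ofReal q) (volume.restrict S)
          = (∫⁻ x in S, ‖g x‖ₑ ^ q) ^ (1 / q) := fun g => by
      rw [eLpNorm_eq_lintegral_rpow_enorm_toReal (by simpa using hq0) ENNReal.ofReal_ne_top,
        ENNReal.toReal_ofReal hq0.le]
    obtain ⟨M, hM, hb⟩ := exists_setLIntegral_rpow_le K hd hq0 hqN' hSt
    have hmem : ∀ {g : EuclideanSpace ℝ (Fin N) → ℝ}, BesovHalfBound K g →
        MemLp g (ENNReal.ofReal q) (volume.restrict S) := fun {g} hg => by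
      refine ⟨hg.measurable.aestronglyMeasurable, ?_⟩
      rw [hnorm]
      exact ENNReal.rpow_lt_top_of_nonneg (by positivity) ((hb g hg).trans_lt hM.lt_top).ne
    refine ⟨fun k => hmem (hbes _), hmem hwbes, ?_⟩
    have h2 := (tendsto_setLIntegral_rpow hd hq2 hqN' hSt hfbes (hf2 hSt)).comp hτ.tendsto_atTop
    have h3 := h2.ennrpow_const (1 / q)
    rw [ENNReal.zero_rpow_of_pos (by positivity)] at h3
    refine h3.congr fun k => ?_
    rw [hnorm]
    rfl
  · filter_upwards [hae] with x hx
    simpa [hf] using hx.add_const (w x)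

lemma TendstoLqLoc.congr_ae {N : ℕ} {q : ℝ} {f f' : ℕ → EuclideanSpace ℝ (Fin N) → ℝ}
    {g : EuclideanSpace ℝ (Fin N) → ℝ} (h : TendstoLqLoc q f g) (hf : ∀ k, f k =ᵐ[volume] f' k) :
    TendstoLqLoc q f' g := by
  intro K hK
  obtain ⟨h1, h2, h3⟩ := h K hK
  have hr := fun k => ae_restrict_of_ae (s := K) (hf k)
  refine ⟨fun k => (memLp_congr_ae (hr k)).1 (h1 k), h2, h3.congr fun k => ?_⟩
  refine eLpNorm_congr_ae ?_
  filter_upwards [hr k] with x hx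
  simp [hx]

end FracSobolev

theorem theorem3p2 (N : ℕ) [NeZero N] (hN : 3 ≤ N)
    (V : EuclideanSpace ℝ (Fin N) → ℝ) (hV_bdd : MemLp V ⊤ volume)
    (hV_per : ∀ z : Fin N → ℤ, ∀ᵐ x, V (x + WithLp.toLp 2 (fun i => (z i : ℝ))) = V x)
    (hV_pos : ∃ V₀ : ℝ, 0 < V₀ ∧ ∀ᵐ x, V₀ ≤ V x)
    (s : ℕ → ℝ) (hs : ∀ n, 1 / 2 < s n ∧ s n < 1) (hs_lim : Tendsto s atTop (𝓝 1))
    (v : ℕ → EuclideanSpace ℝ (Fin N) → ℝ) (hv : ∀ n, FracSobolev.MemHs (s n) (v n))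
    (hv_bdd : BddAbove (Set.range fun n => FracSobolev.hsNorm V (s n) (v n))) :
    ∃ (w : EuclideanSpace ℝ (Fin N) → ℝ) (σ : ℕ → ℕ), FracSobolev.MemH1 w ∧ StrictMono σ ∧
      (∀ q : ℝ, 2 ≤ q → q < 2 * N / (N - 1) → FracSobolev.TendstoLqLoc q (fun k => v (σ k)) w) ∧
      ∀ᵐ x, Tendsto (fun k => v (σ k) x) atTop (𝓝 (w x)) := by
  obtain ⟨V₀, hV₀, hVV⟩ := hV_pos
  obtain ⟨c, hc, hcs⟩ := FracSobolev.exists_mul_le_fracConst N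
  obtain ⟨B, hB⟩ := hv_bdd
  have hb := fun n => FracSobolev.bounds_of_hsNorm_le hV_bdd hV₀ hVV hc (hs n).2 (hcs _ (hs n).1 (hs n).2)
    (hv n) (hB ⟨n, rfl⟩)
  have hvm := fun n => (hv n).1.aestronglyMeasurable
  set u : ℕ → EuclideanSpace ℝ (Fin N) → ℝ := fun n => (hvm n).mk (v n) with hu
  have hae : ∀ n, v n =ᵐ[volume] u n := fun n => (hvm n).ae_eq_mk
  obtain ⟨w, σ, hw, hσ, hLq, hlim⟩ := FracSobolev.exists_subseq_of_bounds (by omega) hs hs_lim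
    (fun n => (hvm n).stronglyMeasurable_mk.measurable)
    (K₀ := (B ^ 2 / V₀).toNNReal) (K₁ := (2 * B ^ 2 / c).toNNReal)
    (fun n => by
      have e : ∫⁻ x, ‖v n x‖ₑ ^ 2 = ∫⁻ x, ‖u n x‖ₑ ^ 2 :=
        lintegral_congr_ae ((hae n).fun_comp fun y => ‖y‖ₑ ^ 2)
      exact e ▸ (hb n).1)
    (fun n => by
      rw [← FracSobolev.gagliardoSq_congr_ae (s n) (hae n)]
      exact (hb n).2)
  refine ⟨w, σ, hw, hσ, fun q h2 hq => (hLq q h2 hq).congr_ae fun k => (hae (σ k)).symm, ?_⟩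
  filter_upwards [hlim, ae_all_iff.2 hae] with x hx hxe
  exact hx.congr fun k => (hxe (σ k)).symm
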